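/- Let $n_1\le n_2$, let $\Phi:\mathbb{R}^{n_1\times n_2}\to\mathbb{R}^m$ be linear, and let $f:\mathbb{R}^m\to\mathbb{R}\cup\{\infty\}$ be a proper lower semicontinuous convex function that is twice continuously differentiable with positive definite Hessian on the interior of its domain. Write $\sigma_1(X)\ge\dots\ge\sigma_{n_1}(X)$ for the singular values of $X\in\mathbb{R}^{n_1\times n_2}$, $\|X\|_*=\sum_{i}\sigma_i(X)$ for its nuclear norm, and $\operatorname{Diag}\sigma(X)$ for the $n_1\times n_2$ matrix with the $\sigma_i(X)$ on its main diagonal and zeros elsewhere. Adjoints and subgradients on $\mathbb{R}^{n_1\times n_2}$ are taken with respect to the Frobenius inner product $\langle X,Y\rangle=\operatorname{Tr}(X^TY)$. Let $\bar X$ be an optimal solution of $$\min_{X\in\mathbb{R}^{n_1\times n_2}}\ f(\Phi X)+\|X\|_*$$ with $\Phi\bar X\in\operatorname{int}(\operatorname{dom} f)$, and put $\bar Y:=-\Phi^*\nabla f(\Phi\bar X)$, $r:=\operatorname{rank}\bar X$ and $p:=\#\{i\mid\sigma_i(\bar Y)=1\}$. Then $\bar Y\in\partial\|\bar X\|_*$,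 and there are orthogonal matrices $\bar U\in\mathbb{R}^{n_1\times n_1}$, $\bar V\in\mathbb{R}^{n_2\times n_2}$ with $$\bar X=\bar U(\operatorname{Diag}\sigma(\bar X))\bar V^T\quad\text{and}\quad \bar Y=\bar U(\operatorname{Diag}\sigma(\bar Y))\bar V^T .$$ Moreover, for every such pair $(\bar U,\bar V)$, $\bar X$ is the unique optimal solution of the problem if and only if, for all symmetric $A\in\mathbb{R}^{r\times r}$, all $B\in\mathbb{R}^{r\times(p-r)}$ and all symmetric positive semidefinite $C\in\mathbb{R}^{(p-r)\times(p-r)}$, $$\Phi\left(\bar U\begin{pmatrix}A&BC&0\\ C^TB^T&C&0\\ 0&0&0\end{pmatrix}\bar V^T\right)=0\quad\Longrightarrow\quad A=C=0 .$$ -/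

import Mathlib

open scoped Matrix

namespace LowRank

noncomputable section

/-! ### Matrices: Frobenius inner product, singular values, nuclear norm -/

/-- The Frobenius inner product `Tr (Xᵀ Y)`. -/
def frobInner {n₁ n₂ : ℕ} (X Y : Matrix (Fin n₁) (Fin n₂) ℝ) : ℝ := (Xᵀ * Y).trace

/-- The singular values of `X` in decreasing order, with multiplicities, indexed from `0`;
they are those of the linear map `v ↦ X v` between Euclidean spaces. -/
def sigma {n₁ n₂ : ℕ} (X : Matrix (Fin n₁) (Fin n₂) ℝ) (i : ℕ) : ℝ :=
  (Matrix.toEuclideanLin X).singularValues i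

/-- The nuclear norm, the sum of the `n₁` singular values of an `n₁ × n₂` matrix (`n₁ ≤ n₂`). -/
def nuclearNorm {n₁ n₂ : ℕ} (X : Matrix (Fin n₁) (Fin n₂) ℝ) : ℝ := ∑ i : Fin n₁, sigma X i

/-- `p(Y)`, the number of indices `i` with `σᵢ(Y) = 1`. -/
def numUnitSigma {n₁ n₂ : ℕ} (Y : Matrix (Fin n₁) (Fin n₂) ℝ) : ℕ :=
  (Finset.univ.filter fun i : Fin n₁ => sigma Y i = 1).card

/-- The `n₁ × n₂` matrix with the ordered singular values of `X` on its main diagonal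
and zeros elsewhere. -/
def diagSigma {n₁ n₂ : ℕ} (X : Matrix (Fin n₁) (Fin n₂) ℝ) : Matrix (Fin n₁) (Fin n₂) ℝ :=
  Matrix.of fun i j => if (i : ℕ) = (j : ℕ) then sigma X i else 0

/-- `(U, V)` is a pair of orthogonal matrices giving an ordered singular value
decomposition of `X`. -/
def IsSVDPair {n₁ n₂ : ℕ} (U : Matrix (Fin n₁) (Fin n₁) ℝ) (V : Matrix (Fin n₂) (Fin n₂) ℝ)
    (X : Matrix (Fin n₁) (Fin n₂) ℝ) : Prop :=
  U ∈ Matrix.orthogonalGroup (Fin n₁) ℝ ∧ V ∈ Matrix.orthogonalGroup (Fin n₂) ℝ ∧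
    X = U * diagSigma X * Vᵀ

/-- Place a `k × k` matrix in the upper left corner of an `n₁ × n₂` matrix and fill with zeros. -/
def padZero {k : ℕ} (n₁ n₂ : ℕ) (M : Matrix (Fin k) (Fin k) ℝ) : Matrix (Fin n₁) (Fin n₂) ℝ :=
  Matrix.of fun i j =>
    if h : (i : ℕ) < k ∧ (j : ℕ) < k then M ⟨i, h.1⟩ ⟨j, h.2⟩ else 0

/-- The `n₁ × n₂` matrix with rows of blocks `(A, BC, 0)`, `(CᵀBᵀ, C, 0)`, `(0, 0, 0)`. -/
def blockABC {r q : ℕ} (n₁ n₂ : ℕ) (A : Matrix (Fin r) (Fin r) ℝ) (B : Matrix (Fin r) (Fin q) ℝ)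
    (C : Matrix (Fin q) (Fin q) ℝ) : Matrix (Fin n₁) (Fin n₂) ℝ :=
  padZero n₁ n₂
    (Matrix.reindex finSumFinEquiv finSumFinEquiv
      (Matrix.fromBlocks A (B * C) (Cᵀ * Bᵀ) C))

/-- The adjoint `Φ*` of `Φ : ℝ^{n₁×n₂} → ℝᵐ` with respect to the Frobenius inner product and the
Euclidean inner product; `inner_map_eq_frobInner_adjoint` is its defining identity. -/
def adjoint {n₁ n₂ m : ℕ} (Φ : Matrix (Fin n₁) (Fin n₂) ℝ →ₗ[ℝ] EuclideanSpace ℝ (Fin m))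
    (y : EuclideanSpace ℝ (Fin m)) : Matrix (Fin n₁) (Fin n₂) ℝ :=
  Matrix.of fun i j => inner ℝ (Φ (Matrix.single i j 1)) y

theorem inner_map_eq_frobInner_adjoint {n₁ n₂ m : ℕ}
    (Φ : Matrix (Fin n₁) (Fin n₂) ℝ →ₗ[ℝ] EuclideanSpace ℝ (Fin m))
    (X : Matrix (Fin n₁) (Fin n₂) ℝ) (y : EuclideanSpace ℝ (Fin m)) :
    inner ℝ (Φ X) y = frobInner X (adjoint Φ y) := by
  have hX : Φ X = ∑ i, ∑ j, X i j • Φ (Matrix.single i j 1) := by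
    conv_lhs => rw [Matrix.matrix_eq_sum_single X]
    simp only [map_sum]
    refine Finset.sum_congr rfl fun i _ => Finset.sum_congr rfl fun j _ => ?_
    rw [← map_smul, Matrix.smul_single, smul_eq_mul, mul_one]
  rw [hX]
  simp only [sum_inner, real_inner_smul_left, frobInner, adjoint, Matrix.trace, Matrix.diag,
    Matrix.mul_apply, Matrix.transpose_apply, Matrix.of_apply]
  exact Finset.sum_comm

/-- The convex subdifferential of a finite function on matrices,
with respect to the Frobenius inner product. -/
def subdifferential {n₁ n₂ : ℕ} (g : Matrix (Fin n₁) (Fin n₂) ℝ → ℝ)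
    (X : Matrix (Fin n₁) (Fin n₂) ℝ) : Set (Matrix (Fin n₁) (Fin n₂) ℝ) :=
  {Y | ∀ Z, frobInner Y (Z - X) ≤ g Z - g X}

/-! ### Extended-real-valued functions and minimizers -/

/-- The effective domain of `f`. -/
def dom {E : Type*} (f : E → EReal) : Set E := {y | f y < ⊤}

/-- The real values of `f`; they only carry information on `dom f`. -/
def finiteValue {E : Type*} (f : E → EReal) (y : E) : ℝ := (f y).toReal

/-- `f` is a proper lower semicontinuous convex function with values in `ℝ ∪ {∞}`. As `f` never
takes the value `-∞`, it is convex if and only if its domain is a convex set on which the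
real-valued function `f` is convex. -/
structure IsProperLscConvex {m : ℕ} (f : EuclideanSpace ℝ (Fin m) → EReal) : Prop where
  ne_bot : ∀ y, f y ≠ ⊥
  dom_nonempty : (dom f).Nonempty
  lsc : LowerSemicontinuous f
  convex : ConvexOn ℝ (dom f) (finiteValue f)

/-- `f` is twice continuously differentiable with positive definite Hessian on the interior of its
domain. The Hessian is the derivative of the gradient. -/
structure HasPosDefHessian {m : ℕ} (f : EuclideanSpace ℝ (Fin m) → EReal) : Prop where
  contDiffOn : ContDiffOn ℝ 2 (finiteValue f) (interior (dom f))
  hessian_pos : ∀ y ∈ interior (dom f), ∀ v : EuclideanSpace ℝ (Fin m), v ≠ 0 →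
    0 < inner ℝ (fderiv ℝ (gradient (finiteValue f)) y v) v

/-- The objective `X ↦ f (Φ X) + ‖X‖_*`. -/
def objective {n₁ n₂ m : ℕ} (f : EuclideanSpace ℝ (Fin m) → EReal)
    (Φ : Matrix (Fin n₁) (Fin n₂) ℝ →ₗ[ℝ] EuclideanSpace ℝ (Fin m))
    (X : Matrix (Fin n₁) (Fin n₂) ℝ) : EReal :=
  f (Φ X) + ((nuclearNorm X : ℝ) : EReal)

/-- `x` is an optimal solution of the problem of minimizing `φ`. -/
def IsOptimal {E : Type*} (φ : E → EReal) (x : E) : Prop := ∀ z, φ x ≤ φ z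

/-- `x` is the unique optimal solution of the problem of minimizing `φ`. -/
def IsUniqueOptimal {E : Type*} (φ : E → EReal) (x : E) : Prop := ∀ z, z ≠ x → φ x < φ z

end

end LowRank

/-! By Fermat's rule `Y` is a subgradient of the nuclear norm at `X`. By positive homogeneity this
means that `⟨Y, Z⟩ ≤ ‖Z‖_*` for all `Z`, with equality at `X`. A competitor `Z` with `Φ Z ≠ Φ X` is
strictly worse: add the subgradient inequality to the gradient inequality of `f`, which is strict
because the Hessian at `Φ X` is positive definite. On the fiber `Φ Z = Φ X` the value `⟨Y, Z⟩` is
constant, since `Y` lies in the range of `Φ*`, so `Z` ties with `X` exactly when `⟨Y, Z⟩ = ‖Z‖_*`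
(`isUniqueOptimal_iff`).

The matrices with `⟨Y, Z⟩ = ‖Z‖_*` form a cone. In the singular bases of `Y` they are the positive
semidefinite `p × p` matrices `P`, padded with zeros: equality forces left and right singular
vectors to agree and to live where `σ(Y) = 1` (`exists_posSemidef_eq_padZero`,
`nuclearNorm_le_frobInner_of_posSemidef`). The same rigidity gives the simultaneous decomposition,
in whose coordinates `X` is `D = diag(σ₁, …, σ_r, 0, …, 0)`.

It remains to describe the directions along which one can leave `D` inside the semidefinite cone.
The lower block `C` must be positive semidefinite, and the off-diagonal block must vanish on `ker
C`, hence have the form `B C` (`PosSemidef.exists_eq_fromBlocks`). Conversely, a Schur complement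
shows that each such direction is feasible for a small step (`exists_pos_posSemidef_fromBlocks`). As
`ker Φ` is linear, the step length is irrelevant. -/

namespace LowRank

open Module InnerProductSpace Topology Filter

/-! ### Singular values and the singular value decomposition -/

/-- The `n₁ × n₂` matrix with `s 0, s 1, …` on its main diagonal and zeros elsewhere. -/
def rectDiag (n₁ n₂ : ℕ) (s : ℕ → ℝ) : Matrix (Fin n₁) (Fin n₂) ℝ :=
  Matrix.of fun i j => if (i : ℕ) = (j : ℕ) then s i else 0

theorem diagSigma_eq_rectDiag {n₁ n₂ : ℕ} (X : Matrix (Fin n₁) (Fin n₂) ℝ) :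
    diagSigma X = rectDiag n₁ n₂ (sigma X) := rfl

theorem sigma_nonneg {n₁ n₂ : ℕ} (X : Matrix (Fin n₁) (Fin n₂) ℝ) (i : ℕ) : 0 ≤ sigma X i :=
  LinearMap.singularValues_nonneg _ i

theorem sigma_antitone {n₁ n₂ : ℕ} (X : Matrix (Fin n₁) (Fin n₂) ℝ) : Antitone (sigma X) :=
  LinearMap.singularValues_antitone _

theorem rank_eq_finrank_range_toEuclideanLin {n₁ n₂ : ℕ} (X : Matrix (Fin n₁) (Fin n₂) ℝ) :
    X.rank = finrank ℝ (Matrix.toEuclideanLin X).range := by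
  rw [Matrix.toEuclideanLin, Matrix.toLpLin_eq_toLin]
  exact Matrix.rank_eq_finrank_range_toLin _ _ _

theorem sigma_pos_iff {n₁ n₂ : ℕ} (X : Matrix (Fin n₁) (Fin n₂) ℝ) (i : ℕ) :
    0 < sigma X i ↔ i < X.rank := by
  rw [rank_eq_finrank_range_toEuclideanLin]
  exact LinearMap.singularValues_pos_iff_lt_finrank_range _

theorem sigma_eq_zero_of_le {n₁ n₂ : ℕ} (X : Matrix (Fin n₁) (Fin n₂) ℝ) {i : ℕ} (hi : n₁ ≤ i) :
    sigma X i = 0 := by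
  refine le_antisymm (not_lt.1 fun h => ?_) (sigma_nonneg X i)
  rw [sigma_pos_iff] at h
  have := X.rank_le_height
  omega

/-- The columns of an orthonormal basis form an orthogonal matrix. -/
theorem of_orthonormalBasis_mem_orthogonalGroup {n : ℕ}
    (b : OrthonormalBasis (Fin n) ℝ (EuclideanSpace ℝ (Fin n))) :
    (Matrix.of fun i j => b j i) ∈ Matrix.orthogonalGroup (Fin n) ℝ :=
  (EuclideanSpace.basisFun (Fin n) ℝ).toMatrix_orthonormalBasis_mem_orthogonal b

theorem mul_transpose_of_mem {n : ℕ} {U : Matrix (Fin n) (Fin n) ℝ}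
    (hU : U ∈ Matrix.orthogonalGroup (Fin n) ℝ) : U * Uᵀ = 1 :=
  (Matrix.mem_orthogonalGroup_iff _ _).1 hU

theorem transpose_mul_of_mem {n : ℕ} {U : Matrix (Fin n) (Fin n) ℝ}
    (hU : U ∈ Matrix.orthogonalGroup (Fin n) ℝ) : Uᵀ * U = 1 :=
  (Matrix.mem_orthogonalGroup_iff' _ _).1 hU

theorem transpose_mem {n : ℕ} {U : Matrix (Fin n) (Fin n) ℝ}
    (hU : U ∈ Matrix.orthogonalGroup (Fin n) ℝ) : Uᵀ ∈ Matrix.orthogonalGroup (Fin n) ℝ := by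
  rw [Matrix.mem_orthogonalGroup_iff, Matrix.transpose_transpose]
  exact transpose_mul_of_mem hU

theorem mul_rectDiag_apply {n₁ n₂ : ℕ} (s : ℕ → ℝ)
    (U : Matrix (Fin n₁) (Fin n₁) ℝ) (i : Fin n₁) (j : Fin n₂) :
    (U * rectDiag n₁ n₂ s) i j =
      if h : (j : ℕ) < n₁ then U i ⟨j, h⟩ * s j else 0 := by
  rw [Matrix.mul_apply]
  split_ifs with h
  · rw [Finset.sum_eq_single (⟨j, h⟩ : Fin n₁)]
    · simp [rectDiag]
    · intro k _ hk
      have : (k : ℕ) ≠ j := fun e => hk (Fin.ext e)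
      simp [rectDiag, this]
    · simp
  · refine Finset.sum_eq_zero fun k _ => ?_
    have : (k : ℕ) ≠ j := by omega
    simp [rectDiag, this]

theorem mul_rectDiag_mul_transpose_apply {n₁ n₂ : ℕ} (hn : n₁ ≤ n₂) (s : ℕ → ℝ)
    (U : Matrix (Fin n₁) (Fin n₁) ℝ) (V : Matrix (Fin n₂) (Fin n₂) ℝ) (i : Fin n₁) (j : Fin n₂) :
    (U * rectDiag n₁ n₂ s * Vᵀ) i j = ∑ k : Fin n₁, s k * (U i k * V j (Fin.castLE hn k)) := by
  obtain ⟨q, rfl⟩ := Nat.exists_eq_add_of_le hn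
  rw [Matrix.mul_apply, Fin.sum_univ_add]
  simp only [mul_rectDiag_apply, Matrix.transpose_apply]
  simp only [Fin.val_castAdd, Fin.is_lt, dite_true, Fin.eta, Fin.val_natAdd]
  rw [Finset.sum_eq_zero (s := Finset.univ) (f := fun x : Fin q => _), add_zero]
  · refine Finset.sum_congr rfl fun k _ => ?_
    have : Fin.castLE hn k = Fin.castAdd q k := rfl
    rw [this]; ring
  · intro k _
    simp

/-- Singular value decomposition. -/
theorem exists_isSVDPair {n₁ n₂ : ℕ} (hn : n₁ ≤ n₂) (X : Matrix (Fin n₁) (Fin n₂) ℝ) :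
    ∃ U V, IsSVDPair U V X := by
  set T := Matrix.toEuclideanLin X with hT
  have hfin : finrank ℝ (EuclideanSpace ℝ (Fin n₂)) = n₂ := finrank_euclideanSpace_fin
  -- The right singular vectors are eigenvectors of `T* T`; their images under `T` are orthogonal
  -- with lengths `σ`.
  set v := T.isSymmetric_adjoint_comp_self.eigenvectorBasis hfin with hv
  have hinner : ∀ i j, inner ℝ (T (v i)) (T (v j)) = if i = j then sigma X j ^ 2 else 0 := by
    intro i j
    have h1 := T.isSymmetric_adjoint_comp_self.apply_eigenvectorBasis hfin j
    rw [← T.sq_singularValues_fin hfin j, ← hv] at h1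
    rw [← LinearMap.adjoint_inner_right]
    rw [LinearMap.comp_apply] at h1
    rw [h1, inner_smul_right, orthonormal_iff_ite.1 v.orthonormal]
    simp [sigma, hT]
  have hzero : ∀ j : Fin n₂, sigma X j = 0 → T (v j) = 0 := by
    intro j hj
    rw [← inner_self_eq_zero (𝕜 := ℝ), hinner]
    simp [hj]
  let u : Fin n₁ → EuclideanSpace ℝ (Fin n₁) :=
    fun k => (sigma X k)⁻¹ • T (v (Fin.castLE hn k))
  -- Only the normalized images with nonzero singular value are orthonormal; the other left singular
  -- vectors are an arbitrary completion, harmless because they are multiplied by zero.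
  let s : Set (Fin n₁) := {k | sigma X k ≠ 0}
  have hu : Orthonormal ℝ (s.domRestrict u) := by
    rw [orthonormal_iff_ite]
    rintro ⟨i, hi⟩ ⟨j, hj⟩
    simp only [Set.domRestrict_apply, u, inner_smul_left, inner_smul_right, hinner,
      Fin.castLE_inj, Subtype.mk.injEq]
    split_ifs with h
    · subst h
      have : sigma X i ≠ 0 := hi
      simp
      field_simp
    · simp
  obtain ⟨b, hb⟩ := hu.exists_orthonormalBasis_extension_of_card_eq (by simp)
  have hV := of_orthonormalBasis_mem_orthogonalGroup v
  refine ⟨Matrix.of fun i j => b j i, Matrix.of fun i j => v j i,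
    of_orthonormalBasis_mem_orthogonalGroup b, hV, ?_⟩
  have key : X * (Matrix.of fun i j => v j i) = (Matrix.of fun i j => b j i) * diagSigma X := by
    ext i j
    have h1 : (X * (Matrix.of fun i j => v j i)) i j = T (v j) i := by
      simp [hT, Matrix.toLpLin_apply, Matrix.mul_apply, Matrix.mulVec, dotProduct]
    rw [h1, diagSigma_eq_rectDiag, mul_rectDiag_apply]
    split_ifs with h
    · by_cases hs : sigma X j = 0
      · simp [hzero j hs, hs]
      · have h2 : b ⟨j, h⟩ = (sigma X j)⁻¹ • T (v j) := hb ⟨j, h⟩ hs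
        simp only [Matrix.of_apply, h2, PiLp.smul_apply, smul_eq_mul]
        field_simp
    · rw [hzero j (sigma_eq_zero_of_le X (by omega))]
      simp
  rw [← key, Matrix.mul_assoc, mul_transpose_of_mem hV, Matrix.mul_one]

/-! ### Contractions and duality -/

theorem frobInner_eq_sum {n₁ n₂ : ℕ} (X Y : Matrix (Fin n₁) (Fin n₂) ℝ) :
    frobInner X Y = ∑ i, ∑ j, X i j * Y i j := by
  simp only [frobInner, Matrix.trace, Matrix.diag, Matrix.mul_apply, Matrix.transpose_apply]
  exact Finset.sum_comm

theorem transpose_mul_conj_mul {n₁ n₂ : ℕ} (Z : Matrix (Fin n₁) (Fin n₂) ℝ)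
    {U : Matrix (Fin n₁) (Fin n₁) ℝ} {V : Matrix (Fin n₂) (Fin n₂) ℝ}
    (hU : U ∈ Matrix.orthogonalGroup (Fin n₁) ℝ) (hV : V ∈ Matrix.orthogonalGroup (Fin n₂) ℝ) :
    Uᵀ * (U * Z * Vᵀ) * V = Z := by
  rw [Matrix.mul_assoc, Matrix.mul_assoc, transpose_mul_of_mem hV, Matrix.mul_one,
    ← Matrix.mul_assoc, transpose_mul_of_mem hU, Matrix.one_mul]

theorem frobInner_mul_mul_transpose {n₁ n₂ : ℕ} (Q Z : Matrix (Fin n₁) (Fin n₂) ℝ)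
    (U : Matrix (Fin n₁) (Fin n₁) ℝ) (V : Matrix (Fin n₂) (Fin n₂) ℝ) :
    frobInner Q (U * Z * Vᵀ) = frobInner (Uᵀ * Q * V) Z := by
  simp only [frobInner, Matrix.transpose_mul, Matrix.transpose_transpose]
  rw [← Matrix.mul_assoc, Matrix.trace_mul_comm]
  simp only [Matrix.mul_assoc]

theorem frobInner_rectDiag {n₁ n₂ : ℕ} (hn : n₁ ≤ n₂) (Q : Matrix (Fin n₁) (Fin n₂) ℝ)
    (s : ℕ → ℝ) : frobInner Q (rectDiag n₁ n₂ s) = ∑ k : Fin n₁, s k * Q k (Fin.castLE hn k) := by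
  rw [frobInner_eq_sum]
  refine Finset.sum_congr rfl fun i _ => ?_
  rw [Finset.sum_eq_single (Fin.castLE hn i)]
  · simp [rectDiag, mul_comm]
  · intro j _ hj
    have : (i : ℕ) ≠ j := fun e => hj (Fin.ext e.symm)
    simp [rectDiag, this]
  · simp

/-- The operator norm of `Q` is at most `1`. -/
def IsContraction {n₁ n₂ : ℕ} (Q : Matrix (Fin n₁) (Fin n₂) ℝ) : Prop :=
  ∀ u v, 2 * (u ⬝ᵥ Q *ᵥ v) ≤ u ⬝ᵥ u + v ⬝ᵥ v

theorem mulVec_dotProduct_mulVec {n : ℕ} {U : Matrix (Fin n) (Fin n) ℝ}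
    (hU : U ∈ Matrix.orthogonalGroup (Fin n) ℝ) (u : Fin n → ℝ) : U *ᵥ u ⬝ᵥ U *ᵥ u = u ⬝ᵥ u := by
  rw [Matrix.dotProduct_mulVec, Matrix.vecMul_mulVec, transpose_mul_of_mem hU, Matrix.vecMul_one]

theorem IsContraction.transpose_mul_mul {n₁ n₂ : ℕ} {Q : Matrix (Fin n₁) (Fin n₂) ℝ}
    (hQ : IsContraction Q) {U : Matrix (Fin n₁) (Fin n₁) ℝ} {V : Matrix (Fin n₂) (Fin n₂) ℝ}
    (hU : U ∈ Matrix.orthogonalGroup (Fin n₁) ℝ) (hV : V ∈ Matrix.orthogonalGroup (Fin n₂) ℝ) :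
    IsContraction (Uᵀ * Q * V) := by
  intro u v
  have := hQ (U *ᵥ u) (V *ᵥ v)
  rw [mulVec_dotProduct_mulVec hU, mulVec_dotProduct_mulVec hV] at this
  convert this using 2
  rw [Matrix.mul_assoc, ← Matrix.mulVec_mulVec, ← Matrix.mulVec_mulVec, Matrix.dotProduct_mulVec,
    Matrix.vecMul_transpose]

theorem IsContraction.apply_le_one {n₁ n₂ : ℕ} {Q : Matrix (Fin n₁) (Fin n₂) ℝ}
    (hQ : IsContraction Q) (i : Fin n₁) (j : Fin n₂) : Q i j ≤ 1 := by
  have := hQ (Pi.single i 1) (Pi.single j 1)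
  simp at this
  linarith

theorem isContraction_rectDiag_one {n₁ n₂ : ℕ} (hn : n₁ ≤ n₂) :
    IsContraction (rectDiag n₁ n₂ 1) := by
  intro u v
  obtain ⟨q, rfl⟩ := Nat.exists_eq_add_of_le hn
  have h1 : ∀ i, (rectDiag n₁ (n₁ + q) 1 *ᵥ v) i = v (Fin.castAdd q i) := by
    intro i
    rw [Matrix.mulVec, dotProduct, Finset.sum_eq_single (Fin.castAdd q i)]
    · simp [rectDiag]
    · intro j _ hj
      have : (i : ℕ) ≠ j := fun e => hj (Fin.ext e.symm)
      simp [rectDiag, this]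
    · simp
  simp only [dotProduct, h1]
  rw [Fin.sum_univ_add, Finset.mul_sum, ← add_assoc, ← Finset.sum_add_distrib]
  have h2 : 0 ≤ ∑ i : Fin q, v (Fin.natAdd n₁ i) * v (Fin.natAdd n₁ i) :=
    Finset.sum_nonneg fun i _ => mul_self_nonneg _
  have h3 : ∑ i, 2 * (u i * v (Fin.castAdd q i)) ≤
      ∑ i, (u i * u i + v (Fin.castAdd q i) * v (Fin.castAdd q i)) :=
    Finset.sum_le_sum fun i _ => by nlinarith [sq_nonneg (u i - v (Fin.castAdd q i))]
  linarith

/-- Moving the singular vectors of `Z` onto `Q` leaves a contraction paired with a diagonal matrix,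
and the diagonal entries of a contraction are at most `1`. -/
theorem IsContraction.frobInner_le {n₁ n₂ : ℕ} (hn : n₁ ≤ n₂) {Q : Matrix (Fin n₁) (Fin n₂) ℝ}
    (hQ : IsContraction Q) (Z : Matrix (Fin n₁) (Fin n₂) ℝ) : frobInner Q Z ≤ nuclearNorm Z := by
  obtain ⟨U, V, hU, hV, hZ⟩ := exists_isSVDPair hn Z
  conv_lhs => rw [hZ, frobInner_mul_mul_transpose, diagSigma_eq_rectDiag, frobInner_rectDiag hn]
  exact Finset.sum_le_sum fun k _ =>
    mul_le_of_le_one_right (sigma_nonneg Z k) ((hQ.transpose_mul_mul hU hV).apply_le_one _ _)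

/-- The norming contraction is the SVD of `Z` with every singular value replaced by `1`. -/
theorem exists_isContraction_frobInner_eq {n₁ n₂ : ℕ} (hn : n₁ ≤ n₂)
    (Z : Matrix (Fin n₁) (Fin n₂) ℝ) : ∃ Q, IsContraction Q ∧ frobInner Q Z = nuclearNorm Z := by
  obtain ⟨U, V, hU, hV, hZ⟩ := exists_isSVDPair hn Z
  have h1 := (isContraction_rectDiag_one hn).transpose_mul_mul (transpose_mem hU) (transpose_mem hV)
  refine ⟨_, h1, ?_⟩
  nth_rewrite 1 [hZ]
  rw [frobInner_mul_mul_transpose, diagSigma_eq_rectDiag, frobInner_rectDiag hn]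
  refine Finset.sum_congr rfl fun k _ => ?_
  rw [Matrix.transpose_transpose, transpose_mul_conj_mul _ hU hV]
  simp [rectDiag]

theorem frobInner_add_right {n₁ n₂ : ℕ} (Q X Z : Matrix (Fin n₁) (Fin n₂) ℝ) :
    frobInner Q (X + Z) = frobInner Q X + frobInner Q Z := by
  simp [frobInner, Matrix.mul_add]

theorem frobInner_smul_right {n₁ n₂ : ℕ} (Q X : Matrix (Fin n₁) (Fin n₂) ℝ) (c : ℝ) :
    frobInner Q (c • X) = c * frobInner Q X := by
  simp [frobInner]

theorem frobInner_sub_right {n₁ n₂ : ℕ} (Q X Z : Matrix (Fin n₁) (Fin n₂) ℝ) :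
    frobInner Q (X - Z) = frobInner Q X - frobInner Q Z := by
  simp [frobInner, Matrix.mul_sub]

/-- By duality the nuclear norm is a maximum of linear functionals; the functional that norms the
convex combination is tested on both endpoints. -/
theorem convexOn_nuclearNorm {n₁ n₂ : ℕ} (hn : n₁ ≤ n₂) :
    ConvexOn ℝ Set.univ (nuclearNorm : Matrix (Fin n₁) (Fin n₂) ℝ → ℝ) := by
  refine ⟨convex_univ, fun X _ Z _ a b ha hb _ => ?_⟩
  obtain ⟨Q, hQ, h⟩ := exists_isContraction_frobInner_eq hn (a • X + b • Z)
  rw [← h, frobInner_add_right, frobInner_smul_right, frobInner_smul_right]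
  exact add_le_add (mul_le_mul_of_nonneg_left (hQ.frobInner_le hn X) ha)
    (mul_le_mul_of_nonneg_left (hQ.frobInner_le hn Z) hb)

theorem nuclearNorm_two_smul_le {n₁ n₂ : ℕ} (hn : n₁ ≤ n₂) (X : Matrix (Fin n₁) (Fin n₂) ℝ) :
    nuclearNorm ((2 : ℝ) • X) ≤ 2 * nuclearNorm X := by
  obtain ⟨Q, hQ, h⟩ := exists_isContraction_frobInner_eq hn ((2 : ℝ) • X)
  rw [← h, frobInner_smul_right]
  linarith [hQ.frobInner_le hn X]

theorem nuclearNorm_zero {n₁ n₂ : ℕ} :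
    nuclearNorm (0 : Matrix (Fin n₁) (Fin n₂) ℝ) = 0 := by
  simp [nuclearNorm, sigma]

/-- Testing the subgradient inequality at `0` and at `2X` gives the two opposite bounds. -/
theorem frobInner_eq_nuclearNorm_of_mem_subdifferential {n₁ n₂ : ℕ} (hn : n₁ ≤ n₂)
    {X Y : Matrix (Fin n₁) (Fin n₂) ℝ} (h : Y ∈ subdifferential nuclearNorm X) :
    frobInner Y X = nuclearNorm X := by
  have h0 := h 0
  have h2 := h ((2 : ℝ) • X)
  rw [frobInner_sub_right] at h0 h2
  rw [frobInner_smul_right] at h2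
  have h3 : frobInner Y 0 = 0 := by simp [frobInner]
  rw [h3, nuclearNorm_zero] at h0
  linarith [nuclearNorm_two_smul_le hn X]

theorem frobInner_le_of_mem_subdifferential {n₁ n₂ : ℕ} (hn : n₁ ≤ n₂)
    {X Y : Matrix (Fin n₁) (Fin n₂) ℝ} (h : Y ∈ subdifferential nuclearNorm X)
    (Z : Matrix (Fin n₁) (Fin n₂) ℝ) : frobInner Y Z ≤ nuclearNorm Z := by
  have h1 := h Z
  rw [frobInner_sub_right, frobInner_eq_nuclearNorm_of_mem_subdifferential hn h] at h1
  linarith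

/-- Test on the rank-one matrix of the `i`-th singular vectors of `Y`. Its nuclear norm is bounded
through a norming contraction, so its singular values need not be computed. -/
theorem sigma_le_one_of_frobInner_le {n₁ n₂ : ℕ} (hn : n₁ ≤ n₂) {Y : Matrix (Fin n₁) (Fin n₂) ℝ}
    (h : ∀ Z, frobInner Y Z ≤ nuclearNorm Z) (i : Fin n₁) : sigma Y i ≤ 1 := by
  obtain ⟨U, V, hU, hV, hY⟩ := exists_isSVDPair hn Y
  set Z := U * rectDiag n₁ n₂ (Pi.single (i : ℕ) 1) * Vᵀ with hZ
  obtain ⟨Q, hQ, hQZ⟩ := exists_isContraction_frobInner_eq hn Z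
  have e : ∀ W, frobInner W Z = (Uᵀ * W * V) i (Fin.castLE hn i) := by
    intro W
    rw [hZ, frobInner_mul_mul_transpose, frobInner_rectDiag hn, Finset.sum_eq_single i]
    · simp
    · intro j _ hj
      simp [Fin.val_inj, hj]
    · simp
  have h1 := h Z
  rw [← hQZ, e, e] at h1
  have h2 := (hQ.transpose_mul_mul hU hV).apply_le_one i (Fin.castLE hn i)
  have h3 : Uᵀ * Y * V = diagSigma Y := by
    nth_rewrite 1 [hY]
    exact transpose_mul_conj_mul _ hU hV
  rw [h3] at h1
  have h4 : diagSigma Y i (Fin.castLE hn i) = sigma Y i := by simp [diagSigma]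
  linarith

/-! ### Equality in the duality inequality -/

theorem orthogonal_mul_mem {n : ℕ} {U V : Matrix (Fin n) (Fin n) ℝ}
    (hU : U ∈ Matrix.orthogonalGroup (Fin n) ℝ) (hV : V ∈ Matrix.orthogonalGroup (Fin n) ℝ) :
    U * V ∈ Matrix.orthogonalGroup (Fin n) ℝ :=
  mul_mem hU hV

theorem sum_col_sq {n : ℕ} {U : Matrix (Fin n) (Fin n) ℝ}
    (hU : U ∈ Matrix.orthogonalGroup (Fin n) ℝ) (k l : Fin n) :
    ∑ i, U i k * U i l = if k = l then 1 else 0 := by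
  have := congrFun (congrFun (transpose_mul_of_mem hU) k) l
  rwa [Matrix.mul_apply, Matrix.one_apply] at this

/-- The equality case of the duality between the nuclear norm and the operator norm: if `rectDiag d`
is a contraction that norms `U (rectDiag s) Vᵀ`, then the singular vectors for nonzero `s k` agree
and are supported on the coordinates where `d` is `1`. -/
theorem singularVectors_of_frobInner_eq_sum {n₁ n₂ : ℕ} (hn : n₁ ≤ n₂) {d s : ℕ → ℝ}
    (hd0 : ∀ i : Fin n₁, 0 ≤ d i) (hd1 : ∀ i : Fin n₁, d i ≤ 1) (hs : ∀ i, 0 ≤ s i)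
    {U : Matrix (Fin n₁) (Fin n₁) ℝ} {V : Matrix (Fin n₂) (Fin n₂) ℝ}
    (hU : U ∈ Matrix.orthogonalGroup (Fin n₁) ℝ) (hV : V ∈ Matrix.orthogonalGroup (Fin n₂) ℝ)
    (h : frobInner (rectDiag n₁ n₂ d) (U * rectDiag n₁ n₂ s * Vᵀ) = ∑ k : Fin n₁, s k)
    (k : Fin n₁) (hk : 0 < s k) :
    (∀ i, V (Fin.castLE hn i) (Fin.castLE hn k) = U i k) ∧
      (∀ i : Fin n₁, d i ≠ 1 → U i k = 0) ∧
      ∀ j : Fin n₂, n₁ ≤ (j : ℕ) → V j (Fin.castLE hn k) = 0 := by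
  obtain ⟨q, rfl⟩ := Nat.exists_eq_add_of_le hn
  have hc : ∀ i, Fin.castLE hn i = Fin.castAdd q i := fun _ => rfl
  simp only [hc]
  set t : Fin n₁ → ℝ := fun k => ∑ i : Fin n₁, d i * (U i k * V (Fin.castAdd q i) (Fin.castAdd q k))
  -- `t k` is the `k`-th diagonal entry of `Uᵀ (rectDiag d) V`. Since the `k`-th columns of `U` and
  -- `V` are unit vectors, its defect from `1` is a sum of nonnegative terms, and equality makes
  -- each of them vanish.
  have hgap : ∀ k, 2 * (1 - t k) =
      ∑ i : Fin n₁, (d i * (U i k - V (Fin.castAdd q i) (Fin.castAdd q k)) ^ 2 +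
        (1 - d i) * U i k ^ 2 + (1 - d i) * V (Fin.castAdd q i) (Fin.castAdd q k) ^ 2) +
      ∑ j : Fin q, V (Fin.natAdd n₁ j) (Fin.castAdd q k) ^ 2 := by
    intro k
    have h1 := sum_col_sq hU k k
    have h2 := sum_col_sq hV (Fin.castAdd q k) (Fin.castAdd q k)
    rw [Fin.sum_univ_add] at h2
    simp only [if_true] at h1 h2
    have h3 : ∑ i : Fin n₁, (d i * (U i k - V (Fin.castAdd q i) (Fin.castAdd q k)) ^ 2 +
        (1 - d i) * U i k ^ 2 + (1 - d i) * V (Fin.castAdd q i) (Fin.castAdd q k) ^ 2) =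
        ∑ i, U i k * U i k +
        ∑ i, V (Fin.castAdd q i) (Fin.castAdd q k) * V (Fin.castAdd q i) (Fin.castAdd q k) -
        2 * t k := by
      simp only [t]
      rw [Finset.mul_sum, ← Finset.sum_add_distrib, ← Finset.sum_sub_distrib]
      exact Finset.sum_congr rfl fun i _ => by ring
    rw [h3, h1]
    simp only [sq]
    linarith
  have hterm : ∀ k i, 0 ≤ d (i : Fin n₁) * (U i k - V (Fin.castAdd q i) (Fin.castAdd q k)) ^ 2 +
        (1 - d i) * U i k ^ 2 + (1 - d i) * V (Fin.castAdd q i) (Fin.castAdd q k) ^ 2 := by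
    intro k i
    have := hd0 i
    have := sub_nonneg.2 (hd1 i)
    positivity
  have ht : ∀ k, 0 ≤ 1 - t k := by
    intro k
    have : 0 ≤ 2 * (1 - t k) := by
      rw [hgap]
      exact add_nonneg (Finset.sum_nonneg fun i _ => hterm k i)
        (Finset.sum_nonneg fun i _ => sq_nonneg _)
    linarith
  have hsum : ∑ k : Fin n₁, s k * (1 - t k) = 0 := by
    rw [frobInner_mul_mul_transpose, frobInner_rectDiag hn] at h
    have : ∀ k, (Uᵀ * rectDiag n₁ (n₁ + q) d * V) k (Fin.castLE hn k) = t k := by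
      intro k
      have := mul_rectDiag_mul_transpose_apply hn d Uᵀ Vᵀ k (Fin.castLE hn k)
      rw [Matrix.transpose_transpose] at this
      rw [this]
      rfl
    simp only [this] at h
    simp only [mul_sub, mul_one, Finset.sum_sub_distrib, h, sub_self]
  have hk0 := (Finset.sum_eq_zero_iff_of_nonneg
    fun (k : Fin n₁) _ => mul_nonneg (hs k) (ht k)).1 hsum k
    (Finset.mem_univ k)
  have hk1 : 1 - t k = 0 := (mul_eq_zero.1 hk0).resolve_left hk.ne'
  have hg := hgap k
  rw [hk1, mul_zero, eq_comm, add_eq_zero_iff_of_nonneg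
    (Finset.sum_nonneg fun i _ => hterm k i) (Finset.sum_nonneg fun i _ => sq_nonneg _),
    Finset.sum_eq_zero_iff_of_nonneg fun i _ => hterm k i,
    Finset.sum_eq_zero_iff_of_nonneg fun i _ => sq_nonneg _] at hg
  obtain ⟨hg1, hg2⟩ := hg
  have hsplit : ∀ i : Fin n₁, d i * (U i k - V (Fin.castAdd q i) (Fin.castAdd q k)) ^ 2 = 0 ∧
      (1 - d i) * U i k ^ 2 = 0 ∧ (1 - d i) * V (Fin.castAdd q i) (Fin.castAdd q k) ^ 2 = 0 := by
    intro i
    have h0 := hg1 i (Finset.mem_univ i)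
    have a0 := mul_nonneg (hd0 i) (sq_nonneg (U i k - V (Fin.castAdd q i) (Fin.castAdd q k)))
    have b0 := mul_nonneg (sub_nonneg.2 (hd1 i)) (sq_nonneg (U i k))
    have c0 := mul_nonneg (sub_nonneg.2 (hd1 i))
      (sq_nonneg (V (Fin.castAdd q i) (Fin.castAdd q k)))
    exact ⟨by linarith, by linarith, by linarith⟩
  refine ⟨fun i => ?_, fun i hi => ?_, fun j hj => ?_⟩
  · obtain ⟨h1, h2, h3⟩ := hsplit i
    by_cases hi : d i = 1
    · rw [hi, one_mul] at h1
      linarith [pow_eq_zero_iff (two_ne_zero) |>.1 h1]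
    · have hi' : 1 - d i ≠ 0 := fun e => hi (by linarith)
      rw [pow_eq_zero_iff two_ne_zero |>.1 ((mul_eq_zero.1 h2).resolve_left hi'),
        pow_eq_zero_iff two_ne_zero |>.1 ((mul_eq_zero.1 h3).resolve_left hi')]
  · have hi' : 1 - d i ≠ 0 := fun e => hi (by linarith)
    exact pow_eq_zero_iff two_ne_zero |>.1 ((mul_eq_zero.1 (hsplit i).2.1).resolve_left hi')
  · obtain ⟨a, rfl⟩ : ∃ a : Fin q, j = Fin.natAdd n₁ a :=
      ⟨⟨j - n₁, by omega⟩, Fin.ext (by simp; omega)⟩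
    exact pow_eq_zero_iff two_ne_zero |>.1 (hg2 a (Finset.mem_univ a))

theorem frobInner_conj_left {n₁ n₂ : ℕ} (D Z : Matrix (Fin n₁) (Fin n₂) ℝ)
    (U : Matrix (Fin n₁) (Fin n₁) ℝ) (V : Matrix (Fin n₂) (Fin n₂) ℝ) :
    frobInner (U * D * Vᵀ) Z = frobInner D (Uᵀ * Z * V) := by
  have := frobInner_mul_mul_transpose D Z Uᵀ Vᵀ
  rw [Matrix.transpose_transpose, Matrix.transpose_transpose] at this
  exact this.symm

/-! ### The multiplicity of the singular value one -/

theorem numUnitSigma_le {n₁ n₂ : ℕ} (Y : Matrix (Fin n₁) (Fin n₂) ℝ) : numUnitSigma Y ≤ n₁ :=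
  (Finset.card_le_univ _).trans_eq (Fintype.card_fin n₁)

/-- Since `1` is the largest value allowed and the sequence decreases, the indices with value `1`
form an initial segment, determined by its cardinality. -/
theorem sigma_eq_one_iff {n₁ n₂ : ℕ} {Y : Matrix (Fin n₁) (Fin n₂) ℝ}
    (h : ∀ i : Fin n₁, sigma Y i ≤ 1) (i : Fin n₁) : sigma Y i = 1 ↔ (i : ℕ) < numUnitSigma Y := by
  constructor
  · intro hi
    have : Finset.Iic i ⊆ Finset.univ.filter fun i : Fin n₁ => sigma Y i = 1 := by
      intro j hj
      have hji : j ≤ i := Finset.mem_Iic.1 hj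
      refine Finset.mem_filter.2 ⟨Finset.mem_univ _, le_antisymm (h j) ?_⟩
      rw [← hi]
      exact sigma_antitone Y hji
    have := Finset.card_le_card this
    rw [Fin.card_Iic] at this
    exact this
  · contrapose!
    intro hi
    have : (Finset.univ.filter fun i : Fin n₁ => sigma Y i = 1) ⊆ Finset.Iio i := by
      intro j hj
      refine Finset.mem_Iio.2 (not_le.1 fun hij => hi (le_antisymm (h i) ?_))
      rw [← (Finset.mem_filter.1 hj).2]
      exact sigma_antitone Y hij
    have := Finset.card_le_card this
    rw [Fin.card_Iio] at this
    exact this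

/-! ### The face of the nuclear norm ball exposed by `Y` -/

theorem rank_le_of_rows_eq_zero {n₁ n₂ p : ℕ} (hp : p ≤ n₁) (M : Matrix (Fin n₁) (Fin n₂) ℝ)
    (h : ∀ i : Fin n₁, p ≤ (i : ℕ) → ∀ j, M i j = 0) : M.rank ≤ p := by
  have : M = (Matrix.of fun (i : Fin n₁) (a : Fin p) => if (i : ℕ) = a then (1 : ℝ) else 0) *
      M.submatrix (Fin.castLE hp) id := by
    ext i j
    rw [Matrix.mul_apply]
    by_cases hi : (i : ℕ) < p
    · rw [Finset.sum_eq_single (⟨i, hi⟩ : Fin p)]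
      · simp
      · intro a _ ha
        have : (i : ℕ) ≠ a := fun e => ha (Fin.ext e.symm)
        simp [this]
      · simp
    · rw [h i (not_lt.1 hi), Finset.sum_eq_zero]
      intro a _
      have : (i : ℕ) ≠ a := by omega
      simp [this]
  rw [this]
  exact (Matrix.rank_mul_le_left _ _).trans (Matrix.rank_le_width _)

theorem isUnit_det_of_mem {n : ℕ} {U : Matrix (Fin n) (Fin n) ℝ}
    (hU : U ∈ Matrix.orthogonalGroup (Fin n) ℝ) : IsUnit U.det :=
  (Matrix.isUnit_iff_isUnit_det _).1 (.of_mul_eq_one _ (mul_transpose_of_mem hU))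

/-- In coordinates given by an SVD of `Y`, a matrix `Z` on which `⟨Y, ·⟩` attains the nuclear norm
has a decomposition whose singular vectors for nonzero singular values agree and are supported on
the coordinates where `σ(Y)` is `1`. -/
theorem exists_singularVectors_of_frobInner_eq {n₁ n₂ : ℕ} (hn : n₁ ≤ n₂)
    {Y Z : Matrix (Fin n₁) (Fin n₂) ℝ} (hY : ∀ i : Fin n₁, sigma Y i ≤ 1)
    {U : Matrix (Fin n₁) (Fin n₁) ℝ} {V : Matrix (Fin n₂) (Fin n₂) ℝ} (hUV : IsSVDPair U V Y)
    (hZ : frobInner Y Z = nuclearNorm Z) :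
    ∃ U₁ ∈ Matrix.orthogonalGroup (Fin n₁) ℝ, ∃ V₁ ∈ Matrix.orthogonalGroup (Fin n₂) ℝ,
      Uᵀ * Z * V = U₁ * diagSigma Z * V₁ᵀ ∧ ∀ k : Fin n₁, 0 < sigma Z k →
        (∀ i, V₁ (Fin.castLE hn i) (Fin.castLE hn k) = U₁ i k) ∧
        (∀ i : Fin n₁, sigma Y i ≠ 1 → U₁ i k = 0) ∧
        ∀ j : Fin n₂, n₁ ≤ (j : ℕ) → V₁ j (Fin.castLE hn k) = 0 := by
  obtain ⟨hU, hV, hYe⟩ := hUV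
  obtain ⟨U', V', hU', hV', hZe⟩ := exists_isSVDPair hn Z
  have hU₁ := orthogonal_mul_mem (transpose_mem hU) hU'
  have hV₁ := orthogonal_mul_mem (transpose_mem hV) hV'
  have hM : Uᵀ * Z * V = Uᵀ * U' * diagSigma Z * (Vᵀ * V')ᵀ := by
    conv_lhs => rw [hZe]
    simp only [Matrix.transpose_mul, Matrix.transpose_transpose, Matrix.mul_assoc]
  refine ⟨_, hU₁, _, hV₁, hM, fun k hk => ?_⟩
  refine singularVectors_of_frobInner_eq_sum hn (d := sigma Y) (s := sigma Z)
    (fun i => sigma_nonneg Y i) hY (sigma_nonneg Z) hU₁ hV₁ ?_ k hk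
  rw [← diagSigma_eq_rectDiag, ← diagSigma_eq_rectDiag, ← hM, ← frobInner_conj_left, ← hYe, hZ]
  rfl

/-- This makes the natural-number subtraction `p - r` genuine. In the coordinates of `Y`, all rows
of `Z` beyond the first `p` vanish. -/
theorem rank_le_numUnitSigma {n₁ n₂ : ℕ} (hn : n₁ ≤ n₂)
    {Y Z : Matrix (Fin n₁) (Fin n₂) ℝ} (hY : ∀ i : Fin n₁, sigma Y i ≤ 1)
    (hZ : frobInner Y Z = nuclearNorm Z) : Z.rank ≤ numUnitSigma Y := by
  obtain ⟨U, V, hUV⟩ := exists_isSVDPair hn Y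
  obtain ⟨U₁, -, V₁, -, hM, hk⟩ := exists_singularVectors_of_frobInner_eq hn hY hUV hZ
  have hr : (Uᵀ * Z * V).rank = Z.rank := by
    rw [Matrix.rank_mul_eq_left_of_isUnit_det _ _ (isUnit_det_of_mem hUV.2.1),
      Matrix.rank_mul_eq_right_of_isUnit_det _ _ (isUnit_det_of_mem (transpose_mem hUV.1))]
  rw [← hr]
  refine rank_le_of_rows_eq_zero (numUnitSigma_le Y) _ fun i hi j => ?_
  rw [hM, diagSigma_eq_rectDiag, mul_rectDiag_mul_transpose_apply hn]
  refine Finset.sum_eq_zero fun k _ => ?_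
  rcases (sigma_nonneg Z k).eq_or_lt with h0 | h0
  · rw [← h0, zero_mul]
  · rw [(hk k h0).2.1 i (by rw [Ne, sigma_eq_one_iff hY]; omega)]
    ring

/-- Once left and right singular vectors agree, the decomposition reads `∑ σₖ uₖ uₖᵀ` with each
contributing `uₖ` supported on the first `p` coordinates. Here `p` is a free variable so that it can
later be taken in the form `r + q`. -/
theorem exists_posSemidef_eq_padZero {n₁ n₂ p : ℕ} (hn : n₁ ≤ n₂) (hp : p ≤ n₁)
    {Y Z : Matrix (Fin n₁) (Fin n₂) ℝ} (hY : ∀ i : Fin n₁, sigma Y i ≤ 1)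
    (hYp : ∀ i : Fin n₁, sigma Y i = 1 ↔ (i : ℕ) < p)
    {U : Matrix (Fin n₁) (Fin n₁) ℝ} {V : Matrix (Fin n₂) (Fin n₂) ℝ} (hUV : IsSVDPair U V Y)
    (hZ : frobInner Y Z = nuclearNorm Z) :
    ∃ P : Matrix (Fin p) (Fin p) ℝ, P.PosSemidef ∧ Uᵀ * Z * V = padZero n₁ n₂ P := by
  obtain ⟨U₁, -, V₁, -, hM, hk⟩ := exists_singularVectors_of_frobInner_eq hn hY hUV hZ
  refine ⟨∑ k : Fin n₁, sigma Z k • Matrix.vecMulVec (fun a => U₁ (Fin.castLE hp a) k)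
    (star fun a => U₁ (Fin.castLE hp a) k), ?_, ?_⟩
  · exact Matrix.posSemidef_sum _ fun k _ =>
      (Matrix.posSemidef_vecMulVec_self_star _).smul (sigma_nonneg Z k)
  · ext i j
    rw [hM, diagSigma_eq_rectDiag, mul_rectDiag_mul_transpose_apply hn, padZero, Matrix.of_apply]
    split_ifs with h
    · rw [Matrix.sum_apply]
      refine Finset.sum_congr rfl fun k _ => ?_
      rcases (sigma_nonneg Z k).eq_or_lt with h0 | h0
      · simp [← h0]
      · have hj : j = Fin.castLE hn ⟨j, h.2.trans_le hp⟩ := rfl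
        have hV : V₁ j (Fin.castLE hn k) = U₁ ⟨j, h.2.trans_le hp⟩ k := by
          rw [← (hk k h0).1, ← hj]
        rw [hV]
        simp [Matrix.vecMulVec_apply, Fin.castLE]
    · refine Finset.sum_eq_zero fun k _ => ?_
      rcases (sigma_nonneg Z k).eq_or_lt with h0 | h0
      · simp [← h0]
      by_cases hi : (i : ℕ) < p
      · by_cases hj : (j : ℕ) < n₁
        · have hj' : j = Fin.castLE hn ⟨j, hj⟩ := rfl
          rw [hj', (hk k h0).1, (hk k h0).2.1 ⟨j, hj⟩ (by rw [Ne, hYp]; simp; omega)]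
          ring
        · rw [(hk k h0).2.2 j (not_lt.1 hj)]
          ring
      · rw [(hk k h0).2.1 i (by rw [Ne, hYp]; exact hi)]
        ring

theorem frobInner_padZero {n₁ n₂ p : ℕ} (h₁ : p ≤ n₁) (h₂ : p ≤ n₂)
    (Q : Matrix (Fin n₁) (Fin n₂) ℝ) (P : Matrix (Fin p) (Fin p) ℝ) :
    frobInner Q (padZero n₁ n₂ P) =
      ∑ a, ∑ b, Q (Fin.castLE h₁ a) (Fin.castLE h₂ b) * P a b := by
  obtain ⟨q₁, rfl⟩ := Nat.exists_eq_add_of_le h₁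
  obtain ⟨q₂, rfl⟩ := Nat.exists_eq_add_of_le h₂
  rw [frobInner_eq_sum, Fin.sum_univ_add]
  simp only [Fin.sum_univ_add]
  simp [padZero]
  rfl

theorem IsContraction.submatrix_castLE {n₁ n₂ p : ℕ} (h₁ : p ≤ n₁) (h₂ : p ≤ n₂)
    {Q : Matrix (Fin n₁) (Fin n₂) ℝ} (hQ : IsContraction Q) :
    IsContraction (Q.submatrix (Fin.castLE h₁) (Fin.castLE h₂)) := by
  intro u v
  obtain ⟨q₁, rfl⟩ := Nat.exists_eq_add_of_le h₁
  obtain ⟨q₂, rfl⟩ := Nat.exists_eq_add_of_le h₂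
  have := hQ (Fin.append u 0) (Fin.append v 0)
  simp only [dotProduct, Matrix.mulVec, Fin.sum_univ_add, Fin.append_left, Fin.append_right] at this
  simpa [dotProduct, Matrix.mulVec] using! this

/-- For `P = v vᵀ` this is the contraction inequality with both vectors equal to `v`; a general `P`
is a sum of such terms. -/
theorem IsContraction.sum_mul_le_trace {p : ℕ} {Q P : Matrix (Fin p) (Fin p) ℝ}
    (hQ : IsContraction Q) (hP : P.PosSemidef) : ∑ a, ∑ b, Q a b * P a b ≤ P.trace := by
  obtain ⟨m, v, rfl⟩ := Matrix.posSemidef_iff_eq_sum_vecMulVec.1 hP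
  have h1 : ∀ i, 2 * ∑ a, ∑ b, Q a b * (v i a * v i b) ≤ 2 * ∑ a, v i a * v i a := by
    intro i
    have := hQ (v i) (v i)
    simp only [dotProduct, Matrix.mulVec, Finset.mul_sum] at this ⊢
    rw [← Finset.sum_add_distrib] at this
    refine le_trans (le_of_eq ?_) (this.trans (le_of_eq ?_))
    · exact Finset.sum_congr rfl fun a _ => Finset.sum_congr rfl fun b _ => by ring
    · exact Finset.sum_congr rfl fun a _ => by ring
  have h2 : ∑ i, ∑ a, ∑ b, Q a b * (v i a * v i b) ≤ ∑ i, ∑ a, v i a * v i a :=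
    Finset.sum_le_sum fun i _ => by linarith [h1 i]
  simp only [Matrix.trace, Matrix.diag, Matrix.sum_apply, Matrix.vecMulVec_apply,
    star_trivial]
  rw [Finset.sum_comm (s := (Finset.univ : Finset (Fin p))) (f := fun a i => v i a * v i a)]
  refine le_trans (le_of_eq ?_) h2
  rw [Finset.sum_comm (s := (Finset.univ : Finset (Fin m)))]
  refine Finset.sum_congr rfl fun a _ => ?_
  rw [Finset.sum_comm (s := (Finset.univ : Finset (Fin m)))]
  exact Finset.sum_congr rfl fun b _ => by rw [Finset.mul_sum]

/-- Converse description of the exposed face. Both sides compare with `tr P`: the norming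
contraction compresses to a contraction on the `p × p` corner, and there `diagSigma Y` is the
identity. -/
theorem nuclearNorm_le_frobInner_of_posSemidef {n₁ n₂ p : ℕ} (hn : n₁ ≤ n₂) (hp : p ≤ n₁)
    {Y : Matrix (Fin n₁) (Fin n₂) ℝ} (hYp : ∀ i : Fin n₁, sigma Y i = 1 ↔ (i : ℕ) < p)
    {U : Matrix (Fin n₁) (Fin n₁) ℝ} {V : Matrix (Fin n₂) (Fin n₂) ℝ} (hUV : IsSVDPair U V Y)
    {P : Matrix (Fin p) (Fin p) ℝ} (hP : P.PosSemidef) :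
    nuclearNorm (U * padZero n₁ n₂ P * Vᵀ) ≤ frobInner Y (U * padZero n₁ n₂ P * Vᵀ) := by
  obtain ⟨hU, hV, hY⟩ := hUV
  obtain ⟨Q, hQ, hQe⟩ := exists_isContraction_frobInner_eq hn (U * padZero n₁ n₂ P * Vᵀ)
  rw [← hQe, frobInner_mul_mul_transpose, frobInner_padZero hp (hp.trans hn)]
  refine (((hQ.transpose_mul_mul hU hV).submatrix_castLE hp (hp.trans hn)).sum_mul_le_trace
    hP).trans (le_of_eq ?_)
  conv_rhs => rw [hY]
  rw [frobInner_conj_left, transpose_mul_conj_mul _ hU hV, frobInner_padZero hp (hp.trans hn),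
    Matrix.trace]
  refine Finset.sum_congr rfl fun a _ => ?_
  rw [Finset.sum_eq_single a]
  · have := (hYp (Fin.castLE hp a)).2 (by simp)
    simp only [Fin.val_castLE] at this
    simp [diagSigma, this]
  · intro b _ hb
    have : (a : ℕ) ≠ b := fun e => hb (Fin.ext e.symm)
    simp [diagSigma, this]
  · simp

/-- Simultaneous ordered singular value decomposition. -/
theorem exists_simultaneous_isSVDPair {n₁ n₂ : ℕ} (hn : n₁ ≤ n₂)
    {X Y : Matrix (Fin n₁) (Fin n₂) ℝ} (hY : ∀ i : Fin n₁, sigma Y i ≤ 1)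
    (hX : frobInner Y X = nuclearNorm X) : ∃ U V, IsSVDPair U V X ∧ IsSVDPair U V Y := by
  have hrp := rank_le_numUnitSigma hn hY hX
  obtain ⟨U, V, hUV⟩ := exists_isSVDPair hn Y
  obtain ⟨U₁, hU₁, V₁, hV₁, hM, hk⟩ := exists_singularVectors_of_frobInner_eq hn hY hUV hX
  have hpos : ∀ k : Fin n₁, 0 < sigma X k → sigma Y k = 1 := by
    intro k h
    rw [sigma_pos_iff] at h
    rw [sigma_eq_one_iff hY]
    omega
  -- Keep the singular vectors of `X` for positive singular values and the standard basis vectors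
  -- where `σ(Y) ≠ 1`. They are orthogonal because the former vanish on those coordinates; the
  -- remaining indices are filled by completion.
  let v : Fin n₁ → EuclideanSpace ℝ (Fin n₁) := fun k =>
    if 0 < sigma X k then WithLp.toLp 2 fun i => U₁ i k else EuclideanSpace.single k 1
  let s : Set (Fin n₁) := {k | 0 < sigma X k ∨ sigma Y k ≠ 1}
  have hv : Orthonormal ℝ (s.domRestrict v) := by
    rw [orthonormal_iff_ite]
    rintro ⟨i, hi⟩ ⟨j, hj⟩
    have hcol := sum_col_sq hU₁ j i
    simp only [Set.domRestrict_apply, v, Subtype.mk.injEq]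
    by_cases hi0 : 0 < sigma X i <;> by_cases hj0 : 0 < sigma X j
    · simp only [hi0, hj0, if_true, PiLp.inner_apply, RCLike.inner_apply, conj_trivial]
      simpa only [eq_comm] using hcol
    · have hne : i ≠ j := by rintro rfl; exact hj0 hi0
      simp only [hi0, hj0, hne, if_true, if_false, EuclideanSpace.inner_single_right]
      simp [(hk i hi0).2.1 j (hj.resolve_left hj0)]
    · have hne : i ≠ j := by rintro rfl; exact hi0 hj0
      simp only [hi0, hj0, hne, if_true, if_false, EuclideanSpace.inner_single_left]
      simp [(hk j hj0).2.1 i (hi.resolve_left hi0)]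
    · simp only [hi0, hj0, if_false, EuclideanSpace.inner_single_left]
      simp
  obtain ⟨b, hb⟩ := hv.exists_orthonormalBasis_extension_of_card_eq (by simp)
  set B : Matrix (Fin n₁) (Fin n₁) ℝ := Matrix.of fun i j => b j i with hB
  have hBmem : B ∈ Matrix.orthogonalGroup (Fin n₁) ℝ := of_orthonormalBasis_mem_orthogonalGroup b
  have hB1 : ∀ k : Fin n₁, 0 < sigma X k → ∀ i, B i k = U₁ i k := by
    intro k h i
    simp [hB, hb k (Or.inl h), v, h]
  have hB2 : ∀ k : Fin n₁, sigma Y k ≠ 1 → ∀ i, B i k = if i = k then 1 else 0 := by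
    intro k h i
    have h' : ¬ 0 < sigma X k := fun e => h (hpos k e)
    simp [hB, hb k (Or.inr h), v, h']
  -- `B` is block diagonal with an identity block where `σ(Y) ≠ 1`, so it commutes with the diagonal
  -- of `σ(Y)`. Hence changing both bases by `B` preserves the decomposition of `Y`.
  have hcomm : ∀ i k, sigma Y (k : Fin n₁) * B i k = sigma Y (i : Fin n₁) * B i k := by
    intro i k
    by_cases hk1 : sigma Y k = 1
    · by_cases hi1 : sigma Y i = 1
      · rw [hk1, hi1]
      · have hne : i ≠ k := by rintro rfl; exact hi1 hk1
        have h1 := sum_col_sq hBmem i k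
        simp [hB2 i hi1, hne] at h1
        rw [h1, mul_zero, mul_zero]
    · rw [hB2 k hk1]
      split_ifs with h
      · rw [h]
      · simp
  obtain ⟨q, rfl⟩ := Nat.exists_eq_add_of_le hn
  have hc : ∀ i, Fin.castLE hn i = Fin.castAdd q i := fun _ => rfl
  set C : Matrix (Fin (n₁ + q)) (Fin (n₁ + q)) ℝ :=
    Matrix.reindex finSumFinEquiv finSumFinEquiv (Matrix.fromBlocks B 0 0 1) with hC
  have hCmem : C ∈ Matrix.orthogonalGroup (Fin (n₁ + q)) ℝ := by
    rw [Matrix.mem_orthogonalGroup_iff, hC, Matrix.transpose_reindex, Matrix.reindex_apply,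
      Matrix.reindex_apply, Matrix.submatrix_mul_equiv, Matrix.fromBlocks_transpose,
      Matrix.fromBlocks_multiply]
    simp [mul_transpose_of_mem hBmem]
  have hC1 : ∀ j k, C (Fin.castAdd q j) (Fin.castAdd q k) = B j k := by
    intro j k
    simp [hC]
  have hC2 : ∀ j k, C (Fin.natAdd n₁ j) (Fin.castAdd q k) = 0 := by
    intro j k
    simp [hC]
  have hD : B * diagSigma Y * Cᵀ = diagSigma Y := by
    ext i j
    rw [diagSigma_eq_rectDiag, mul_rectDiag_mul_transpose_apply hn]
    simp only [hc]
    refine Fin.addCases (fun j => ?_) (fun j => ?_) j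
    · simp only [hC1, ← mul_assoc, hcomm]
      simp only [mul_assoc, ← Finset.mul_sum]
      have := congrFun (congrFun (mul_transpose_of_mem hBmem) i) j
      simp only [Matrix.mul_apply, Matrix.transpose_apply, Matrix.one_apply] at this
      rw [this]
      simp [rectDiag, Fin.val_inj]
    · have : (i : ℕ) ≠ n₁ + j := by omega
      simp [hC2, rectDiag, this]
  have hE : B * diagSigma X * Cᵀ = Uᵀ * X * V := by
    rw [hM]
    ext i j
    rw [diagSigma_eq_rectDiag, mul_rectDiag_mul_transpose_apply hn,
      mul_rectDiag_mul_transpose_apply hn]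
    refine Finset.sum_congr rfl fun k _ => ?_
    rcases (sigma_nonneg X k).eq_or_lt with h0 | h0
    · rw [← h0, zero_mul, zero_mul]
    obtain ⟨h1, -, h3⟩ := hk k h0
    rw [hB1 k h0]
    congr 2
    simp only [hc] at h1 h3 ⊢
    refine Fin.addCases (fun j => ?_) (fun j => ?_) j
    · rw [hC1, h1, hB1 k h0]
    · rw [hC2, h3 _ (by simp)]
  obtain ⟨hU, hV, hYe⟩ := hUV
  have hconj : ∀ W : Matrix (Fin n₁) (Fin (n₁ + q)) ℝ, (U * B) * W * (V * C)ᵀ = U * (B * W * Cᵀ) * Vᵀ := by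
    intro W
    simp only [Matrix.transpose_mul, Matrix.mul_assoc]
  refine ⟨U * B, V * C, ⟨orthogonal_mul_mem hU hBmem, orthogonal_mul_mem hV hCmem, ?_⟩,
    ⟨orthogonal_mul_mem hU hBmem, orthogonal_mul_mem hV hCmem, ?_⟩⟩
  · rw [hconj, hE]
    have := transpose_mul_conj_mul X (transpose_mem hU) (transpose_mem hV)
    rw [Matrix.transpose_transpose, Matrix.transpose_transpose] at this
    exact this.symm
  · rw [hconj, hD]
    exact hYe

/-! ### Positive semidefinite block matrices -/

/-- `E` factors through the range of `C`: compose it with a section of `C`, extended from the range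
to the whole space. -/
theorem exists_eq_mul_of_forall_mulVec_eq_zero {m n : Type*} [Fintype m] [Fintype n]
    [DecidableEq n] (E : Matrix m n ℝ) (C : Matrix n n ℝ)
    (h : ∀ x, C *ᵥ x = 0 → E *ᵥ x = 0) : ∃ B : Matrix m n ℝ, E = B * C := by
  obtain ⟨g, hg⟩ := C.mulVecLin.rangeRestrict.exists_rightInverse_of_surjective
    C.mulVecLin.range_rangeRestrict
  obtain ⟨G, hG⟩ := LinearMap.exists_extend g
  refine ⟨E * LinearMap.toMatrix' G, Matrix.toLin'.injective (LinearMap.ext fun x => ?_)⟩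
  have h1 : C *ᵥ (G (C *ᵥ x)) = C *ᵥ x := by
    have h2 : G (C *ᵥ x) = g (C.mulVecLin.rangeRestrict x) :=
      LinearMap.congr_fun hG (C.mulVecLin.rangeRestrict x)
    have h3 := LinearMap.congr_fun hg (C.mulVecLin.rangeRestrict x)
    rw [h2]
    exact congrArg Subtype.val h3
  have h4 := h (x - G (C *ᵥ x)) (by rw [Matrix.mulVec_sub, h1, sub_self])
  rw [Matrix.mulVec_sub, sub_eq_zero] at h4
  simp only [Matrix.toLin'_apply, ← Matrix.mulVec_mulVec, LinearMap.toMatrix'_mulVec]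
  exact h4

/-- If `C x = 0`, the quadratic form of `P` vanishes at `(0, x)`; semidefiniteness then puts `(0,
x)` in `ker P`, so the upper right block kills `x` and is a multiple `B C`. -/
theorem PosSemidef.exists_eq_fromBlocks {m n : Type*} [Fintype m] [Fintype n]
    [DecidableEq n] {P : Matrix (m ⊕ n) (m ⊕ n) ℝ} (hP : P.PosSemidef) :
    ∃ (A : Matrix m m ℝ) (B : Matrix m n ℝ) (C : Matrix n n ℝ), A.IsSymm ∧ C.PosSemidef ∧
      P = Matrix.fromBlocks A (B * C) (Cᵀ * Bᵀ) C := by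
  have hsymm : Pᵀ = P := by simpa [Matrix.IsHermitian] using hP.1
  have hC : P.toBlocks₂₂.PosSemidef := hP.submatrix Sum.inr
  obtain ⟨B, hB⟩ := exists_eq_mul_of_forall_mulVec_eq_zero P.toBlocks₁₂ P.toBlocks₂₂ (by
    intro x hx
    have hblock : P *ᵥ Sum.elim 0 x = Sum.elim (P.toBlocks₁₂ *ᵥ x) (P.toBlocks₂₂ *ᵥ x) := by
      conv_lhs => rw [← P.fromBlocks_toBlocks, Matrix.fromBlocks_mulVec]
      simp
    have h1 := (hP.dotProduct_mulVec_zero_iff (Sum.elim 0 x)).1 (by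
      rw [hblock, hx, star_trivial, sumElim_dotProduct_sumElim]
      simp)
    rw [hblock] at h1
    funext i
    exact congrFun h1 (Sum.inl i))
  refine ⟨P.toBlocks₁₁, B, P.toBlocks₂₂, ?_, hC, ?_⟩
  · ext i j
    exact congrFun (congrFun hsymm (Sum.inl i)) (Sum.inl j)
  · rw [← Matrix.transpose_mul, ← hB]
    have h21 : P.toBlocks₁₂ᵀ = P.toBlocks₂₁ := by
      ext i j
      exact congrFun (congrFun hsymm (Sum.inr i)) (Sum.inl j)
    rw [h21, Matrix.fromBlocks_toBlocks]

theorem PosSemidef.fromBlocks_zero_zero {m n : Type*} [Fintype m] [Fintype n]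
    {A : Matrix m m ℝ} {C : Matrix n n ℝ} (hA : A.PosSemidef) (hC : C.PosSemidef) :
    (Matrix.fromBlocks A 0 0 C).PosSemidef := by
  refine .of_dotProduct_mulVec_nonneg
    (Matrix.IsHermitian.fromBlocks hA.1 (by simp) hC.1) fun x => ?_
  have h1 := hA.dotProduct_mulVec_nonneg (x ∘ Sum.inl)
  have h2 := hC.dotProduct_mulVec_nonneg (x ∘ Sum.inr)
  rw [Matrix.fromBlocks_mulVec]
  conv_rhs => rw [← Sum.elim_comp_inl_inr x]
  rw [star_trivial] at h1 h2 ⊢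
  rw [sumElim_dotProduct_sumElim]
  simpa using add_nonneg h1 h2

theorem neg_sum_abs_mul_le_dotProduct_mulVec {m : Type*} [Fintype m] (N : Matrix m m ℝ)
    (x : m → ℝ) : -((∑ i, ∑ j, |N i j|) * (x ⬝ᵥ x)) ≤ x ⬝ᵥ N *ᵥ x := by
  have hle : ∀ i, x i ^ 2 ≤ x ⬝ᵥ x := fun i => by
    rw [sq]
    exact Finset.single_le_sum (f := fun i => x i * x i) (fun i _ => mul_self_nonneg _)
      (Finset.mem_univ i)
  simp only [Finset.sum_mul]
  rw [← Finset.sum_neg_distrib]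
  simp only [← Finset.sum_neg_distrib]
  conv_rhs => rw [dotProduct]
  simp only [Matrix.mulVec, dotProduct, Finset.mul_sum]
  refine Finset.sum_le_sum fun i _ => Finset.sum_le_sum fun j _ => ?_
  have h1 : |x i * x j| ≤ x ⬝ᵥ x := by
    rw [abs_mul]
    nlinarith [sq_nonneg (|x i| - |x j|), sq_abs (x i), sq_abs (x j), hle i, hle j]
  have h2 := neg_abs_le (x i * (N i j * x j))
  have h3 : |x i * (N i j * x j)| = |N i j| * |x i * x j| := by
    rw [← abs_mul]; ring_nf
  have h4 := mul_le_mul_of_nonneg_left h1 (abs_nonneg (N i j))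
  simp only [dotProduct, Finset.mul_sum] at h4
  linarith

theorem exists_pos_posSemidef_diagonal_add_smul {m : Type*} [Fintype m] [DecidableEq m]
    {d : m → ℝ} (hd : ∀ i, 0 < d i) {N : Matrix m m ℝ} (hN : N.IsSymm) :
    ∃ t : ℝ, 0 < t ∧ (Matrix.diagonal d + t • N).PosSemidef := by
  obtain ⟨δ, hδ, hδd⟩ : ∃ δ : ℝ, 0 < δ ∧ ∀ i, δ ≤ d i := by
    rcases isEmpty_or_nonempty m with h | h
    · exact ⟨1, one_pos, fun i => h.elim i⟩
    · obtain ⟨i, hi⟩ := Finite.exists_min d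
      exact ⟨d i, hd i, hi⟩
  set K := ∑ i, ∑ j, |N i j| with hK
  have hK0 : 0 ≤ K := Finset.sum_nonneg fun i _ => Finset.sum_nonneg fun j _ => abs_nonneg _
  -- `K` bounds the quadratic form of `N` and `δ` is a lower bound for `d`; adding `1` avoids
  -- division by zero when `N = 0`.
  refine ⟨δ / (K + 1), by positivity, .of_dotProduct_mulVec_nonneg ?_ fun x => ?_⟩
  · rw [Matrix.IsHermitian, Matrix.conjTranspose_eq_transpose_of_trivial, Matrix.transpose_add,
      Matrix.transpose_smul, hN.eq, Matrix.diagonal_transpose]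
  · rw [star_trivial, Matrix.add_mulVec, dotProduct_add, Matrix.smul_mulVec, dotProduct_smul,
      smul_eq_mul]
    have h1 := neg_sum_abs_mul_le_dotProduct_mulVec N x
    rw [← hK] at h1
    have hxx : 0 ≤ x ⬝ᵥ x := Finset.sum_nonneg fun i _ => mul_self_nonneg (x i)
    have h2 : δ * (x ⬝ᵥ x) ≤ x ⬝ᵥ Matrix.diagonal d *ᵥ x := by
      simp only [dotProduct, Matrix.mulVec_diagonal, Finset.mul_sum]
      exact Finset.sum_le_sum fun i _ => by
        nlinarith [mul_le_mul_of_nonneg_right (hδd i) (mul_self_nonneg (x i))]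
    have h3 := mul_le_mul_of_nonneg_left h1 (show 0 ≤ δ / (K + 1) by positivity)
    have h4 : δ / (K + 1) * (K * (x ⬝ᵥ x)) ≤ δ * (x ⬝ᵥ x) := by
      rw [← mul_assoc]
      refine mul_le_mul_of_nonneg_right ?_ hxx
      rw [div_mul_eq_mul_div, div_le_iff₀ (by positivity)]
      nlinarith
    linarith

/-- Congruence by the unipotent matrix with upper right block `B` reduces to the blocks `diag d + t
(A - B C Bᵀ)` and `t C`. The second is semidefinite for every `t ≥ 0`, so `t` need only be small for
the first. -/
theorem exists_pos_posSemidef_fromBlocks {m n : Type*} [Fintype m] [Fintype n] [DecidableEq m]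
    [DecidableEq n] {d : m → ℝ} (hd : ∀ i, 0 < d i) {A : Matrix m m ℝ} (hA : A.IsSymm)
    (B : Matrix m n ℝ) {C : Matrix n n ℝ} (hC : C.PosSemidef) :
    ∃ t : ℝ, 0 < t ∧ (Matrix.fromBlocks (Matrix.diagonal d) 0 0 0 +
      t • Matrix.fromBlocks A (B * C) (Cᵀ * Bᵀ) C).PosSemidef := by
  have hCt : Cᵀ = C := by simpa [Matrix.IsHermitian] using hC.1
  have hN : (A - B * C * Bᵀ).IsSymm := by
    rw [Matrix.IsSymm, Matrix.transpose_sub, hA.eq]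
    simp [Matrix.transpose_mul, hCt, Matrix.mul_assoc]
  obtain ⟨t, ht, hP⟩ := exists_pos_posSemidef_diagonal_add_smul hd hN
  refine ⟨t, ht, ?_⟩
  have h1 := (PosSemidef.fromBlocks_zero_zero hP (hC.smul ht.le)).mul_mul_conjTranspose_same
    (Matrix.fromBlocks 1 B 0 1 : Matrix (m ⊕ n) (m ⊕ n) ℝ)
  convert h1 using 1
  rw [Matrix.conjTranspose_eq_transpose_of_trivial, Matrix.fromBlocks_transpose,
    Matrix.fromBlocks_multiply, Matrix.fromBlocks_multiply, Matrix.fromBlocks_smul,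
    Matrix.fromBlocks_add]
  simp only [Matrix.one_mul, Matrix.mul_one, Matrix.mul_zero, Matrix.zero_mul, add_zero, zero_add,
    Matrix.transpose_one, Matrix.transpose_zero, hCt, Matrix.mul_smul, Matrix.smul_mul]
  congr 1
  rw [smul_sub]
  abel

/-! ### Gradient inequalities -/

section Gradient

variable {E : Type*} [NormedAddCommGroup E] [InnerProductSpace ℝ E] [CompleteSpace E]

theorem hasDerivAt_comp_line {g : E → ℝ} {v x h : E} (t : ℝ) (hg : HasGradientAt g v (x + t • h)) :
    HasDerivAt (fun t : ℝ => g (x + t • h)) (inner ℝ v h) t := by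
  have h1 : HasDerivAt (fun t : ℝ => x + t • h) h t := by
    simpa using ((hasDerivAt_id t).smul_const h).const_add x
  have := hg.hasFDerivAt.comp_hasDerivAt t h1
  simpa using! this

/-- The gradient inequality for convex functions. -/
theorem add_inner_gradient_le {s : Set E} {g : E → ℝ} (hg : ConvexOn ℝ s g) {v x y : E}
    (hx : x ∈ s) (hy : y ∈ s) (hv : HasGradientAt g v x) : g x + inner ℝ v (y - x) ≤ g y := by
  have h1 : ConvexOn ℝ (Set.Icc (0 : ℝ) 1) (g ∘ AffineMap.lineMap x y) := by
    refine (hg.comp_affineMap (AffineMap.lineMap x y)).subset ?_ (convex_Icc 0 1)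
    intro t ht
    exact hg.1.lineMap_mem hx hy ht
  have h2 : (g ∘ AffineMap.lineMap x y : ℝ → ℝ) = fun t => g (x + t • (y - x)) := by
    funext t
    simp [AffineMap.lineMap_apply, add_comm]
  have h3 : HasDerivAt (g ∘ AffineMap.lineMap x y : ℝ → ℝ) (inner ℝ v (y - x)) 0 := by
    rw [h2]
    exact hasDerivAt_comp_line 0 (by simpa using hv)
  have h4 := h1.le_slope_of_hasDerivAt (Set.left_mem_Icc.2 zero_le_one)
    (Set.right_mem_Icc.2 zero_le_one) zero_lt_one h3
  simp [slope_def_field] at h4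
  linarith

/-- The strict gradient inequality at a point where the Hessian is positive definite. -/
theorem add_inner_gradient_lt {s : Set E} {g : E → ℝ} (hg : ConvexOn ℝ s g) {x y : E}
    (hx : x ∈ interior s) (hy : y ∈ s) (hdiff : ∀ z ∈ interior s, DifferentiableAt ℝ g z)
    (hgrad : DifferentiableAt ℝ (gradient g) x)
    (hpos : 0 < inner ℝ (fderiv ℝ (gradient g) x (y - x)) (y - x)) :
    g x + inner ℝ (gradient g x) (y - x) < g y := by
  set h := y - x with hh
  have hline : HasDerivAt (fun t : ℝ => x + t • h) h 0 := by
    simpa using ((hasDerivAt_id (0 : ℝ)).smul_const h).const_add x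
  have hφ : HasDerivAt (fun t : ℝ => inner ℝ (gradient g (x + t • h)) h)
      (inner ℝ (fderiv ℝ (gradient g) x h) h) 0 := by
    have h1 : HasFDerivAt (gradient g) (fderiv ℝ (gradient g) x) (x + (0 : ℝ) • h) := by
      simpa using hgrad.hasFDerivAt
    have h2 := h1.comp_hasDerivAt (0 : ℝ) hline
    simpa using h2.inner ℝ (hasDerivAt_const (0 : ℝ) h)
  -- Positive curvature at `x` alone makes the directional derivative larger at a nearby point `x +
  -- t h`. Chaining the gradient inequality from `x` to that point and from there to `y` gives
  -- strictness.
  have h1 : ∀ᶠ t in 𝓝[>] (0 : ℝ), 0 < slope (fun t : ℝ => inner ℝ (gradient g (x + t • h)) h) 0 t :=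
    ((hasDerivAt_iff_tendsto_slope.1 hφ).mono_left
      (nhdsWithin_mono _ fun t (ht : 0 < t) => ht.ne')).eventually (lt_mem_nhds hpos)
  have h2 : ∀ᶠ t in 𝓝[>] (0 : ℝ), x + t • h ∈ interior s := by
    refine nhdsWithin_le_nhds (hline.continuousAt.eventually_mem ?_)
    simpa using isOpen_interior.mem_nhds hx
  have h3 : ∀ᶠ t in 𝓝[>] (0 : ℝ), t < 1 := nhdsWithin_le_nhds (gt_mem_nhds zero_lt_one)
  obtain ⟨t, ht1, ht2, ht3, ht0⟩ := (h1.and (h2.and (h3.and self_mem_nhdsWithin))).exists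
  have ht0 : 0 < t := ht0
  simp only [slope_def_field, sub_zero, zero_smul, add_zero] at ht1
  have ht1 := (div_pos_iff_of_pos_right ht0).1 ht1
  have a1 := add_inner_gradient_le hg (interior_subset hx) (interior_subset ht2)
    (hdiff x hx).hasGradientAt
  have a2 := add_inner_gradient_le hg (interior_subset ht2) hy (hdiff _ ht2).hasGradientAt
  have e1 : x + t • h - x = t • h := by abel
  have e2 : y - (x + t • h) = (1 - t) • h := by
    rw [hh]; module
  rw [e1, inner_smul_right] at a1
  rw [e2, inner_smul_right] at a2
  nlinarith

end Gradient

/-! ### Padding with zeros -/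

theorem padZero_add {k n₁ n₂ : ℕ} (M N : Matrix (Fin k) (Fin k) ℝ) :
    padZero n₁ n₂ (M + N) = padZero n₁ n₂ M + padZero n₁ n₂ N := by
  ext i j
  simp only [padZero, Matrix.of_apply, Matrix.add_apply]
  split_ifs <;> simp

theorem padZero_smul {k n₁ n₂ : ℕ} (c : ℝ) (M : Matrix (Fin k) (Fin k) ℝ) :
    padZero n₁ n₂ (c • M) = c • padZero n₁ n₂ M := by
  ext i j
  simp only [padZero, Matrix.of_apply, Matrix.smul_apply]
  split_ifs <;> simp

theorem padZero_eq_zero_iff {k n₁ n₂ : ℕ} (h₁ : k ≤ n₁) (h₂ : k ≤ n₂)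
    {M : Matrix (Fin k) (Fin k) ℝ} : padZero n₁ n₂ M = 0 ↔ M = 0 := by
  constructor
  · intro h
    ext a b
    have := congrFun (congrFun h (Fin.castLE h₁ a)) (Fin.castLE h₂ b)
    simpa [padZero] using this
  · rintro rfl
    ext i j
    simp [padZero]

/-- Any padding `q` works because singular values vanish from index `rank X` on. This places `X` in
the same corner as its competitors. -/
theorem diagSigma_eq_padZero {n₁ n₂ : ℕ} (X : Matrix (Fin n₁) (Fin n₂) ℝ) (q : ℕ) :
    diagSigma X = padZero n₁ n₂ (Matrix.reindex finSumFinEquiv finSumFinEquiv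
      (Matrix.fromBlocks (Matrix.diagonal fun i : Fin X.rank => sigma X i) 0 0
        (0 : Matrix (Fin q) (Fin q) ℝ))) := by
  ext i j
  simp only [diagSigma, padZero, Matrix.of_apply, Matrix.reindex_apply, Matrix.submatrix_apply]
  by_cases hi : (i : ℕ) < X.rank
  · have hi' : finSumFinEquiv.symm (⟨i, by omega⟩ : Fin (X.rank + q)) = Sum.inl ⟨i, hi⟩ := by
      rw [Equiv.symm_apply_eq]; rfl
    by_cases hj : (j : ℕ) < X.rank
    · have hj' : finSumFinEquiv.symm (⟨j, by omega⟩ : Fin (X.rank + q)) = Sum.inl ⟨j, hj⟩ := by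
        rw [Equiv.symm_apply_eq]; rfl
      rw [dif_pos ⟨by omega, by omega⟩, hi', hj', Matrix.fromBlocks_apply₁₁,
        Matrix.diagonal_apply]
      simp
    · have hne : (i : ℕ) ≠ j := by omega
      rw [if_neg hne]
      split_ifs with h
      · have hj' : finSumFinEquiv.symm (⟨j, h.2⟩ : Fin (X.rank + q)) =
            Sum.inr ⟨j - X.rank, by omega⟩ := by
          rw [Equiv.symm_apply_eq]; ext; simp; omega
        rw [hi', hj', Matrix.fromBlocks_apply₁₂, Matrix.zero_apply]
      · rfl
  · have h0 : sigma X i = 0 :=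
      le_antisymm (not_lt.1 fun e => hi ((sigma_pos_iff X i).1 e)) (sigma_nonneg X i)
    rw [h0, ite_self]
    split_ifs with h
    · have hi' : finSumFinEquiv.symm (⟨i, h.1⟩ : Fin (X.rank + q)) =
          Sum.inr ⟨i - X.rank, by omega⟩ := by
        rw [Equiv.symm_apply_eq]; ext; simp; omega
      rw [hi']
      rcases finSumFinEquiv.symm (⟨j, h.2⟩ : Fin (X.rank + q)) with a | a <;> simp
    · rfl

theorem frobInner_comm {n₁ n₂ : ℕ} (X Y : Matrix (Fin n₁) (Fin n₂) ℝ) :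
    frobInner X Y = frobInner Y X := by
  simp only [frobInner_eq_sum, mul_comm]

/-! ### Optimality -/

section Optimality

variable {n₁ n₂ m : ℕ} {Φ : Matrix (Fin n₁) (Fin n₂) ℝ →ₗ[ℝ] EuclideanSpace ℝ (Fin m)}
  {f : EuclideanSpace ℝ (Fin m) → EReal}

theorem IsProperLscConvex.coe_finiteValue (hf : IsProperLscConvex f)
    {y : EuclideanSpace ℝ (Fin m)} (hy : y ∈ dom f) : ((finiteValue f y : ℝ) : EReal) = f y :=
  EReal.coe_toReal (LT.lt.ne hy) (hf.ne_bot y)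

theorem IsProperLscConvex.objective_eq (hf : IsProperLscConvex f)
    {X : Matrix (Fin n₁) (Fin n₂) ℝ} (hX : Φ X ∈ dom f) :
    objective f Φ X = ((finiteValue f (Φ X) + nuclearNorm X : ℝ) : EReal) := by
  rw [objective, ← hf.coe_finiteValue hX, EReal.coe_add]

theorem HasPosDefHessian.differentiableAt (hf₂ : HasPosDefHessian f)
    {y : EuclideanSpace ℝ (Fin m)} (hy : y ∈ interior (dom f)) :
    DifferentiableAt ℝ (finiteValue f) y :=
  (hf₂.contDiffOn.contDiffAt (isOpen_interior.mem_nhds hy)).differentiableAt (by norm_num)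

theorem HasPosDefHessian.differentiableAt_gradient (hf₂ : HasPosDefHessian f)
    {y : EuclideanSpace ℝ (Fin m)} (hy : y ∈ interior (dom f)) :
    DifferentiableAt ℝ (gradient (finiteValue f)) y := by
  have h1 : ContDiffAt ℝ 1 (fderiv ℝ (finiteValue f)) y :=
    (hf₂.contDiffOn.contDiffAt (isOpen_interior.mem_nhds hy)).fderiv_right (by norm_num)
  have h2 : DifferentiableAt ℝ (fderiv ℝ (finiteValue f)) y := h1.differentiableAt (by norm_num)
  exact (InnerProductSpace.toDual ℝ (EuclideanSpace ℝ (Fin m))).symm.toContinuousLinearEquiv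
    |>.differentiableAt.comp y h2

theorem HasPosDefHessian.add_inner_lt (hf : IsProperLscConvex f) (hf₂ : HasPosDefHessian f)
    {x y : EuclideanSpace ℝ (Fin m)} (hx : x ∈ interior (dom f)) (hy : y ∈ dom f) (hne : y ≠ x) :
    finiteValue f x + inner ℝ (gradient (finiteValue f) x) (y - x) < finiteValue f y :=
  add_inner_gradient_lt hf.convex hx hy (fun _ hz => hf₂.differentiableAt hz)
    (hf₂.differentiableAt_gradient hx) (hf₂.hessian_pos x hx _ (sub_ne_zero.2 hne))

theorem frobInner_neg_adjoint (y : EuclideanSpace ℝ (Fin m)) (W : Matrix (Fin n₁) (Fin n₂) ℝ) :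
    frobInner (-adjoint Φ y) W = -inner ℝ y (Φ W) := by
  rw [real_inner_comm, inner_map_eq_frobInner_adjoint, frobInner_comm W]
  simp [frobInner]

/-- First-order optimality condition. -/
theorem neg_adjoint_gradient_mem_subdifferential (hn : n₁ ≤ n₂) (hf : IsProperLscConvex f)
    (hf₂ : HasPosDefHessian f) {X : Matrix (Fin n₁) (Fin n₂) ℝ}
    (hX : IsOptimal (objective f Φ) X) (hdom : Φ X ∈ interior (dom f)) :
    -adjoint Φ (gradient (finiteValue f) (Φ X)) ∈ subdifferential nuclearNorm X := by
  intro Z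
  rw [frobInner_neg_adjoint, neg_le, neg_sub]
  set h := Φ (Z - X) with hh
  have hder : HasDerivAt (fun t : ℝ => finiteValue f (Φ X + t • h))
      (inner ℝ (gradient (finiteValue f) (Φ X)) h) 0 :=
    hasDerivAt_comp_line 0 (by simpa using (hf₂.differentiableAt hdom).hasGradientAt)
  have htend : Tendsto (slope (fun t : ℝ => finiteValue f (Φ X + t • h)) 0) (𝓝[>] 0)
      (𝓝 (inner ℝ (gradient (finiteValue f) (Φ X)) h)) :=
    (hasDerivAt_iff_tendsto_slope.1 hder).mono_left
      (nhdsWithin_mono (0 : ℝ) fun t (ht : 0 < t) => ht.ne')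
  have hmem : ∀ᶠ t in 𝓝[>] (0 : ℝ), Φ X + t • h ∈ interior (dom f) := by
    have hc : ContinuousAt (fun t : ℝ => Φ X + t • h) 0 := by fun_prop
    refine nhdsWithin_le_nhds (hc.eventually_mem ?_)
    simpa using isOpen_interior.mem_nhds hdom
  have hlt : ∀ᶠ t in 𝓝[>] (0 : ℝ), t < 1 := nhdsWithin_le_nhds (gt_mem_nhds zero_lt_one)
  -- Only `f` is differentiated: optimality along the segment to `Z`, with convexity of the nuclear
  -- norm, bounds every difference quotient of `f` from below by `‖X‖_* - ‖Z‖_*`.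
  refine ge_of_tendsto htend ?_
  filter_upwards [hmem, hlt, self_mem_nhdsWithin] with t ht1 ht2 ht0
  have ht0 : 0 < t := ht0
  have hmap : Φ ((1 - t) • X + t • Z) = Φ X + t • h := by
    rw [hh, map_add, map_smul, map_smul, map_sub]; module
  have h1 := hX ((1 - t) • X + t • Z)
  rw [hf.objective_eq (interior_subset hdom),
    hf.objective_eq (by rw [hmap]; exact interior_subset ht1), hmap, EReal.coe_le_coe_iff] at h1
  have h2 := (convexOn_nuclearNorm hn).2 (Set.mem_univ X) (Set.mem_univ Z)
    (sub_nonneg.2 ht2.le) ht0.le (by ring)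
  simp only [smul_eq_mul] at h2
  rw [slope_def_field]
  simp only [sub_zero, zero_smul, add_zero]
  rw [le_div_iff₀ ht0]
  linarith

/-- An optimal solution `X` is unique if and only if `X` is the only matrix in its fiber of `Φ` on
which the dual certificate attains the nuclear norm. -/
theorem isUniqueOptimal_iff (hn : n₁ ≤ n₂) (hf : IsProperLscConvex f)
    (hf₂ : HasPosDefHessian f) {X Y : Matrix (Fin n₁) (Fin n₂) ℝ}
    (hdom : Φ X ∈ interior (dom f)) (hY : Y = -adjoint Φ (gradient (finiteValue f) (Φ X)))
    (hsub : Y ∈ subdifferential nuclearNorm X) :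
    IsUniqueOptimal (objective f Φ) X ↔
      ∀ Z, Φ Z = Φ X → nuclearNorm Z ≤ frobInner Y Z → Z = X := by
  have hYX := frobInner_eq_nuclearNorm_of_mem_subdifferential hn hsub
  have hfiber : ∀ Z, Φ Z = Φ X → frobInner Y Z = nuclearNorm X := by
    intro Z hZ
    have h1 : frobInner Y (Z - X) = 0 := by
      rw [hY, frobInner_neg_adjoint, map_sub, hZ, sub_self, inner_zero_right, neg_zero]
    rw [frobInner_sub_right] at h1
    linarith
  have hXd := interior_subset hdom
  constructor
  · intro hu Z hZ hle
    by_contra hne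
    have h1 := hu Z hne
    rw [hf.objective_eq hXd, hf.objective_eq (by rw [hZ]; exact hXd), hZ,
      EReal.coe_lt_coe_iff] at h1
    rw [hfiber Z hZ] at hle
    linarith
  · intro H Z hne
    by_cases hZd : Φ Z ∈ dom f
    · rw [hf.objective_eq hXd, hf.objective_eq hZd, EReal.coe_lt_coe_iff]
      by_cases hZ : Φ Z = Φ X
      · have h1 : frobInner Y Z < nuclearNorm Z := not_le.1 fun e => hne (H Z hZ e)
        rw [hfiber Z hZ] at h1
        rw [hZ]
        linarith
      · have h1 := hf₂.add_inner_lt hf hdom hZd hZ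
        have h2 := hsub Z
        rw [hY, frobInner_neg_adjoint, map_sub] at h2
        linarith
    · have htop : f (Φ Z) = ⊤ := not_lt_top_iff.1 hZd
      rw [hf.objective_eq hXd, objective, htop, EReal.top_add_coe]
      exact EReal.coe_lt_top _

end Optimality

end LowRank

theorem corollary3p6 {n₁ n₂ m : ℕ} (hn : n₁ ≤ n₂)
    (Φ : Matrix (Fin n₁) (Fin n₂) ℝ →ₗ[ℝ] EuclideanSpace ℝ (Fin m))
    (f : EuclideanSpace ℝ (Fin m) → EReal)
    (hf : LowRank.IsProperLscConvex f) (hf₂ : LowRank.HasPosDefHessian f)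
    (X Y : Matrix (Fin n₁) (Fin n₂) ℝ)
    (hX : LowRank.IsOptimal (LowRank.objective f Φ) X)
    (hdom : Φ X ∈ interior (LowRank.dom f))
    (hY : Y = -LowRank.adjoint Φ (gradient (LowRank.finiteValue f) (Φ X))) :
    Y ∈ LowRank.subdifferential LowRank.nuclearNorm X ∧
    (∃ U V, LowRank.IsSVDPair U V X ∧ LowRank.IsSVDPair U V Y) ∧
    ∀ U V, LowRank.IsSVDPair U V X → LowRank.IsSVDPair U V Y →
      (LowRank.IsUniqueOptimal (LowRank.objective f Φ) X ↔
        ∀ (A : Matrix (Fin X.rank) (Fin X.rank) ℝ)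
          (B : Matrix (Fin X.rank) (Fin (LowRank.numUnitSigma Y - X.rank)) ℝ)
          (C : Matrix (Fin (LowRank.numUnitSigma Y - X.rank))
            (Fin (LowRank.numUnitSigma Y - X.rank)) ℝ),
          A.IsSymm → C.PosSemidef →
          Φ (U * LowRank.blockABC n₁ n₂ A B C * Vᵀ) = 0 → A = 0 ∧ C = 0) := by
  open LowRank in
  have hsub : Y ∈ subdifferential nuclearNorm X := by
    rw [hY]
    exact neg_adjoint_gradient_mem_subdifferential hn hf hf₂ hX hdom
  have hYle := frobInner_le_of_mem_subdifferential hn hsub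
  have hσ := sigma_le_one_of_frobInner_le hn hYle
  have hYX := frobInner_eq_nuclearNorm_of_mem_subdifferential hn hsub
  have hrp := rank_le_numUnitSigma hn hσ hYX
  refine ⟨hsub, exists_simultaneous_isSVDPair hn hσ hYX, fun U V hUVX hUVY => ?_⟩
  rw [isUniqueOptimal_iff hn hf hf₂ hdom hY hsub]
  set q := numUnitSigma Y - X.rank with hq
  -- The subtraction in `q` is not truncated, by `hrp`.
  have hrq : X.rank + q = numUnitSigma Y := by omega
  have hp : X.rank + q ≤ n₁ := hrq ▸ numUnitSigma_le Y
  have hYp : ∀ i : Fin n₁, sigma Y i = 1 ↔ (i : ℕ) < X.rank + q := by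
    rw [hrq]; exact sigma_eq_one_iff hσ
  obtain ⟨hU, hV, hXe⟩ := hUVX
  have hXD := diagSigma_eq_padZero X q
  set D : Matrix (Fin X.rank ⊕ Fin q) (Fin X.rank ⊕ Fin q) ℝ :=
    Matrix.fromBlocks (Matrix.diagonal fun i : Fin X.rank => sigma X i) 0 0 0 with hD
  have hXpad : X = U * padZero n₁ n₂ (Matrix.reindex finSumFinEquiv finSumFinEquiv D) * Vᵀ := by
    rw [← hXD]
    exact hXe
  -- The off-diagonal blocks vanish with `C`, so the conclusion `A = C = 0` says that the whole
  -- direction is zero.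
  have hzero : ∀ (A : Matrix (Fin X.rank) (Fin X.rank) ℝ) (B : Matrix (Fin X.rank) (Fin q) ℝ)
      (C : Matrix (Fin q) (Fin q) ℝ), blockABC n₁ n₂ A B C = 0 ↔ A = 0 ∧ C = 0 := by
    intro A B C
    rw [blockABC, padZero_eq_zero_iff hp (hp.trans hn)]
    constructor
    · intro h
      have h' : Matrix.fromBlocks A (B * C) (Cᵀ * Bᵀ) C = 0 :=
        (Matrix.reindex finSumFinEquiv finSumFinEquiv).injective (h.trans (by simp))
      rw [← Matrix.fromBlocks_zero, Matrix.fromBlocks_inj] at h'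
      exact ⟨h'.1, h'.2.2.2⟩
    · rintro ⟨rfl, rfl⟩
      simp
  have hcancel : ∀ W : Matrix (Fin n₁) (Fin n₂) ℝ, U * (Uᵀ * W * V) * Vᵀ = W := by
    intro W
    have := transpose_mul_conj_mul W (transpose_mem hU) (transpose_mem hV)
    rwa [Matrix.transpose_transpose, Matrix.transpose_transpose] at this
  constructor
  -- A small step from `X` along the direction stays in the fiber and in the face, so uniqueness
  -- forces the direction to vanish.
  · intro H A B C hA hC hΦ
    obtain ⟨t, ht, hP⟩ := exists_pos_posSemidef_fromBlocks
      (d := fun i : Fin X.rank => sigma X i) (fun i => (sigma_pos_iff X i).2 i.2) hA B hC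
    have hZ : X + t • (U * blockABC n₁ n₂ A B C * Vᵀ) = U * padZero n₁ n₂
        (Matrix.reindex finSumFinEquiv finSumFinEquiv
          (D + t • Matrix.fromBlocks A (B * C) (Cᵀ * Bᵀ) C)) * Vᵀ := by
      have : Matrix.reindex finSumFinEquiv finSumFinEquiv
          (D + t • Matrix.fromBlocks A (B * C) (Cᵀ * Bᵀ) C) =
          Matrix.reindex finSumFinEquiv finSumFinEquiv D +
          t • Matrix.reindex finSumFinEquiv finSumFinEquiv
            (Matrix.fromBlocks A (B * C) (Cᵀ * Bᵀ) C) := rfl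
      rw [this, padZero_add, padZero_smul, Matrix.mul_add, Matrix.add_mul, Matrix.mul_smul,
        Matrix.smul_mul, blockABC, ← hXpad]
    have h1 := H (X + t • (U * blockABC n₁ n₂ A B C * Vᵀ)) (by simp [hΦ]) (by
      rw [hZ]
      exact nuclearNorm_le_frobInner_of_posSemidef hn hp hYp hUVY (hP.submatrix _))
    have h2 : U * blockABC n₁ n₂ A B C * Vᵀ = 0 :=
      (smul_eq_zero.1 (add_eq_left.1 h1)).resolve_left ht.ne'
    rw [← hzero A B C, ← transpose_mul_conj_mul (blockABC n₁ n₂ A B C) hU hV, h2]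
    simp
  · intro H Z hΦ hle
    obtain ⟨P, hP, hZP⟩ := exists_posSemidef_eq_padZero hn hp hσ hYp hUVY
      (le_antisymm (hYle Z) hle)
    obtain ⟨A, B, C, hA, hC, hPe⟩ := PosSemidef.exists_eq_fromBlocks (hP.submatrix finSumFinEquiv)
    have hPr : P = Matrix.reindex finSumFinEquiv finSumFinEquiv
        (Matrix.fromBlocks A (B * C) (Cᵀ * Bᵀ) C) := by
      rw [← hPe]
      simp
    -- Subtracting `D` changes only the upper left block, so `Z - X` is again an admissible
    -- direction with the same `B` and `C`.
    have hA' : (A - Matrix.diagonal fun i : Fin X.rank => sigma X i).IsSymm :=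
      hA.sub (Matrix.isSymm_diagonal _)
    have hsum : P = Matrix.reindex finSumFinEquiv finSumFinEquiv D +
        Matrix.reindex finSumFinEquiv finSumFinEquiv (Matrix.fromBlocks
          (A - Matrix.diagonal fun i : Fin X.rank => sigma X i) (B * C) (Cᵀ * Bᵀ) C) := by
      have : Matrix.fromBlocks A (B * C) (Cᵀ * Bᵀ) C = D + Matrix.fromBlocks
          (A - Matrix.diagonal fun i : Fin X.rank => sigma X i) (B * C) (Cᵀ * Bᵀ) C := by
        rw [hD, Matrix.fromBlocks_add]
        simp
      rw [hPr, this]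
      rfl
    have hdiff : Z - X = U * blockABC n₁ n₂
        (A - Matrix.diagonal fun i : Fin X.rank => sigma X i) B C * Vᵀ := by
      have h1 : Z = U * padZero n₁ n₂ P * Vᵀ := by rw [← hZP, hcancel]
      rw [hsum, padZero_add, Matrix.mul_add, Matrix.add_mul, ← hXpad] at h1
      rw [h1, add_sub_cancel_left, blockABC]
    have h3 := H _ B C hA' hC (by rw [← hdiff, map_sub, hΦ, sub_self])
    rw [← sub_eq_zero, hdiff, (hzero _ B C).2 h3]
    simp
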